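/- Let $G$ be a multivariate regression (MVR) chain graph with finite vertex set $V$: a graph with directed ($\to$) and bidirected ($\leftrightarrow$) edges and without partially directed cycles, i.e. there is no edge $u\to v$ together with a way back from $v$ to $u$ along edges of the form $a\to b$ or $a\leftrightarrow b$. Notation. The chain components of $G$ are the connected components of its bidirected part, $D$ is the directed acyclic graph of the chain components ($T\to T'$ if $u\to v$ in $G$ for some $u\in T$, $v\in T'$), $pa_D(T)$ is the union of the parents of $T$ in $D$, and $nd_D(T)$ is the union of the components $T'\ne T$ to which there is no directed path from $T$ in $D$. For $A\subseteq V$, $an(A)$ is the set of vertices with a directed path (possibly of length $0$) to a vertex of $A$, $pa_G(A)$ is the set of vertices outside $A$ with a directed edge into $A$, and $Nb_G(A)$ is $A$ together with all vertices joined to $A$ by a bidirected edge; $G_A$ is the subgraph induced on $A$, and $A$ is connected if the bidirected part of $G_A$ is connected. A non-endpoint vertex of a path (with distinct vertices) is a collider on it if both edges of the path at this vertex have an arrowhead there. Fix a strict total order $\prec$ of the chain components such that $T\prec T'$ implies that $T$ is not a parent of $T'$ in $D$, and put $pre(T)=\bigcup_{T\prec T'}T'$. Fix also a strict total order $<$ of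 $V$ such that $x<y$ implies $y\notin an(\{x\})$. Let $\Im$ be an independence model on $V$, that is, a set of statements $A\perp\!\!\!\perp B\mid C$ with $A,B,C\subseteq V$ pairwise disjoint and $A,B\neq\emptyset$ (statements in which $A$ or $B$ is empty count as trivially true), and suppose that $\Im$ is a semi-graphoid: for disjoint $A,B,C,D$ it satisfies symmetry ($A\perp\!\!\!\perp B\mid C\Rightarrow B\perp\!\!\!\perp A\mid C$), decomposition ($A\perp\!\!\!\perp B\cup D\mid C\Rightarrow A\perp\!\!\!\perp B\mid C$ and $A\perp\!\!\!\perp D\mid C$), weak union ($A\perp\!\!\!\perp B\cup D\mid C\Rightarrow A\perp\!\!\!\perp B\mid D\cup C$ and $A\perp\!\!\!\perp D\mid B\cup C$) and contraction ($A\perp\!\!\!\perp B\mid D\cup C$ and $A\perp\!\!\!\perp D\mid C$ $\Leftrightarrow$ $A\perp\!\!\!\perp B\cup D\mid C$). Then the following five conditions are equivalent. (i) Global Markov property: $X\perp\!\!\!\perp Y\mid Z$ is in $\Im$ for all pairwise disjoint $X,Y\ne\emptyset$ and $Z$ such that $X$ and $Y$ are m-separated given $Z$, i.e. on every path between a vertex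 of $X$ and a vertex of $Y$ some noncollider is in $Z$ or some collider is not in $an(Z)$. (ii) Global Markov property in the augmented graph: $X\perp\!\!\!\perp Y\mid Z$ is in $\Im$ for all pairwise disjoint $X,Y\neq\emptyset$ and $Z$ such that $Z$ separates $X$ from $Y$ in the augmented graph $(G_{an(X\cup Y\cup Z)})^a$, the undirected graph on the same vertices in which two distinct vertices are adjacent if and only if they are joined in $G_{an(X\cup Y\cup Z)}$ by a path on which every non-endpoint vertex is a collider. (iii) Block-recursive Markov property of type IV: for every chain component $T$, (IV0) $T\perp\!\!\!\perp nd_D(T)\setminus pa_D(T)\mid pa_D(T)$; (IV1) $A\perp\!\!\!\perp pa_D(T)\setminus pa_G(A)\mid pa_G(A)$ for all $A\subseteq T$; (IV2) $A\perp\!\!\!\perp T\setminus Nb_G(A)\mid pa_D(T)$ for all connected $A\subseteq T$. (iv) Multivariate regression Markov property: for every chain component $T$ and all $A\subseteq T$, (MR1) if $A$ is connected, then $A\perp\!\!\!\perp pre(T)\setminus pa_G(A)\mid pa_G(A)$; (MR2) if $A$ is disconnected with connected components $A_1,\dots,A_r$, then $A_1\perp\!\!\!\perp\cdots\perp\!\!\!\perp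 A_r\mid pre(T)$, i.e. $A_i\perp\!\!\!\perp\bigcup_{j\ne i}A_j\mid pre(T)$ for every $i$. (v) Ordered local Markov property: for every vertex $x$ and every $A\subseteq V$ with $an(A)=A$ and $x\in A\subseteq\{v: v<x\text{ or }v=x\}$, $\{x\}\perp\!\!\!\perp A\setminus(mb(x,A)\cup\{x\})\mid mb(x,A)$, where $mb(x,A)=pa_G(dis_{G_A}(x))\cup(dis_{G_A}(x)\setminus\{x\})$ and $dis_{G_A}(x)$ is the connected component of $x$ in the bidirected part of $G_A$. -/

import Mathlib

namespace MVR

universe u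

/-- A mixed graph with directed edges `u → v` (`dir u v`) and bidirected edges `u ↔ v`
(`bi.Adj u v`).  Forgetting the directed edges gives the bidirected graph `bi`. -/
structure MixedGraph (V : Type u) where
  /-- `dir u v` means that there is a directed edge `u → v` -/
  dir : V → V → Prop
  /-- `bi.Adj u v` means that there is a bidirected edge `u ↔ v` -/
  bi : SimpleGraph V

namespace MixedGraph

variable {V : Type u}

/-- A multivariate regression chain graph: there is no partially directed cycle, that is, no
directed edge `u → v` together with a way back from `v` to `u` along edges of the form `a → b` or
`a ↔ b`.  In particular there are no directed cycles, and no two vertices are joined by more than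
one edge. -/
def IsMVRChainGraph (G : MixedGraph V) : Prop :=
  ∀ u v, G.dir u v → ¬ Relation.ReflTransGen (fun a b => G.dir a b ∨ G.bi.Adj a b) v u

/-- Induced subgraph on the vertex set `A`. -/
def induce (G : MixedGraph V) (A : Set V) : MixedGraph A where
  dir := fun u v => G.dir u v
  bi := G.bi.induce A

/-- `G.an X`: the vertices from which there is a directed path, possibly of length zero, to some
vertex of `X`.  As there are no undirected edges, these are also the vertices anterior to `X`. -/
def an (G : MixedGraph V) (X : Set V) : Set V :=
  {a | ∃ b ∈ X, Relation.ReflTransGen G.dir a b}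

/-- `pa_G(A)`: the vertices outside `A` with a directed edge to some vertex of `A`. -/
def pa (G : MixedGraph V) (A : Set V) : Set V :=
  {w | w ∉ A ∧ ∃ v ∈ A, G.dir w v}

/-- `Nb_G(A)`: the set `A` together with all vertices joined to `A` by a bidirected edge. -/
def nb (G : MixedGraph V) (A : Set V) : Set V :=
  A ∪ {w | ∃ v ∈ A, G.bi.Adj w v}

/-! ### Paths, colliders, m-separation -/

/-- Two distinct vertices are adjacent if they are joined by an edge of some type. -/
def skeleton (G : MixedGraph V) : SimpleGraph V where
  Adj u v := u ≠ v ∧ (G.dir u v ∨ G.dir v u ∨ G.bi.Adj u v)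
  symm := ⟨fun _ _ h => ⟨h.1.symm, by
    rcases h.2 with h | h | h
    · exact Or.inr (Or.inl h)
    · exact Or.inl h
    · exact Or.inr (Or.inr h.symm)⟩⟩
  loopless := ⟨fun _ h => h.1 rfl⟩

/-- The edge between `u` and `v` has an arrowhead at `v`.  (In a multivariate regression chain
graph at most one edge joins `u` and `v`.) -/
def ArrowheadAt (G : MixedGraph V) (u v : V) : Prop :=
  G.dir u v ∨ G.bi.Adj u v

/-- The vertex with index `i + 1` of the walk `p` is a collider on `p`: the edges of `p` that
precede and succeed it both have an arrowhead at it.  Only used for `i + 2 ≤ p.length`, where the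
vertex with index `i + 1` is not an endpoint. -/
def IsColliderAt (G : MixedGraph V) {a b : V} (p : G.skeleton.Walk a b) (i : ℕ) : Prop :=
  G.ArrowheadAt (p.getVert i) (p.getVert (i + 1)) ∧
    G.ArrowheadAt (p.getVert (i + 2)) (p.getVert (i + 1))

/-- The path `p` is m-connecting given `Z`: its endpoints and its noncolliders are not in `Z`, and
its colliders are in `an(Z)`. -/
def IsMConnecting (G : MixedGraph V) {a b : V} (p : G.skeleton.Walk a b) (Z : Set V) : Prop :=
  p.IsPath ∧ a ∉ Z ∧ b ∉ Z ∧ ∀ i, i + 2 ≤ p.length →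
    (G.IsColliderAt p i → p.getVert (i + 1) ∈ G.an Z) ∧
    (¬ G.IsColliderAt p i → p.getVert (i + 1) ∉ Z)

/-- `X` and `Y` are m-separated given `Z`. -/
def MSeparated (G : MixedGraph V) (X Y Z : Set V) : Prop :=
  ∀ a ∈ X, ∀ b ∈ Y, ¬ ∃ p : G.skeleton.Walk a b, G.IsMConnecting p Z

/-! ### The augmented graph, m*-separation -/

/-- `x` and `y` are joined by a path on which every nonendpoint vertex is a collider. -/
def ColliderConnected (G : MixedGraph V) (x y : V) : Prop :=
  ∃ p : G.skeleton.Walk x y, p.IsPath ∧ ∀ i, i + 2 ≤ p.length → G.IsColliderAt p i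

theorem ColliderConnected.symm {G : MixedGraph V} {x y : V} (h : G.ColliderConnected x y) :
    G.ColliderConnected y x := by
  obtain ⟨p, hp, hc⟩ := h
  refine ⟨p.reverse, hp.reverse, fun i hi => ?_⟩
  rw [SimpleGraph.Walk.length_reverse] at hi
  obtain ⟨h1, h2⟩ := hc (p.length - (i + 2)) (by omega)
  have e1 : p.length - (i + 2) + 1 = p.length - (i + 1) := by omega
  have e2 : p.length - (i + 2) + 2 = p.length - i := by omega
  rw [e1] at h1 h2
  rw [e2] at h2
  unfold IsColliderAt
  simp only [SimpleGraph.Walk.getVert_reverse]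
  exact ⟨h2, h1⟩

/-- The augmented graph: two distinct vertices are adjacent if and only if they are collider
connected. -/
def augmented (G : MixedGraph V) : SimpleGraph V where
  Adj x y := x ≠ y ∧ G.ColliderConnected x y
  symm := ⟨fun _ _ h => ⟨h.1.symm, h.2.symm⟩⟩
  loopless := ⟨fun _ h => h.1 rfl⟩

end MixedGraph

/-- Separation in an undirected graph: every path from `X` to `Y` meets `Z`. -/
def Separated {W : Type u} (H : SimpleGraph W) (X Y Z : Set W) : Prop :=
  ∀ x ∈ X, ∀ y ∈ Y, ∀ p : H.Walk x y, p.IsPath → ∃ z ∈ p.support, z ∈ Z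

namespace MixedGraph

variable {V : Type u}

/-- `X` and `Y` are m*-separated given `Z`: they are separated by `Z` in the augmented graph of the
subgraph induced on the ancestors of `X ∪ Y ∪ Z`. -/
def MStarSeparated (G : MixedGraph V) (X Y Z : Set V) : Prop :=
  Separated (G.induce (G.an (X ∪ Y ∪ Z))).augmented
    (Subtype.val ⁻¹' X) (Subtype.val ⁻¹' Y) (Subtype.val ⁻¹' Z)

/-! ### Chain components -/

/-- The chain components are the connected components of the bidirected graph. -/
abbrev ChainComponent (G : MixedGraph V) : Type u := G.bi.ConnectedComponent

/-- The directed graph `D` of chain components: `T₁ → T₂` if some `u → v` has `u ∈ T₁`, `v ∈ T₂`. -/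
def compDir (G : MixedGraph V) (T₁ T₂ : G.ChainComponent) : Prop :=
  ∃ u ∈ T₁.supp, ∃ v ∈ T₂.supp, G.dir u v

/-- `pa_D(T)`: the union of the parents of `T` in `D`. -/
def paD (G : MixedGraph V) (T : G.ChainComponent) : Set V :=
  ⋃ T' ∈ {T' : G.ChainComponent | G.compDir T' T}, T'.supp

/-- `nd_D(T)`: the union of the components `T'` to which there is no directed path (possibly of
length zero, so that `T' ≠ T`) from `T` in `D`. -/
def ndD (G : MixedGraph V) (T : G.ChainComponent) : Set V :=
  ⋃ T' ∈ {T' : G.ChainComponent | ¬ Relation.ReflTransGen G.compDir T T'}, T'.supp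

/-- A strict total order of the chain components such that `T ≺ T'` implies that `T` is not a
parent of `T'` in `D`; so parents are larger than their children. -/
structure IsConsistentCompOrder (G : MixedGraph V)
    (lt : G.ChainComponent → G.ChainComponent → Prop) : Prop where
  isStrictTotalOrder : IsStrictTotalOrder G.ChainComponent lt
  consistent : ∀ T T', lt T T' → ¬ G.compDir T T'

/-- `pre(T)`: the union of all components `T'` with `T ≺ T'`, the past of `T`. -/
def pre (G : MixedGraph V) (lt : G.ChainComponent → G.ChainComponent → Prop)
    (T : G.ChainComponent) : Set V :=
  ⋃ T' ∈ {T' : G.ChainComponent | lt T T'}, T'.supp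

/-- A set of vertices is connected if the bidirected graph induced on it is connected. -/
def ConnectedSet (G : MixedGraph V) (A : Set V) : Prop :=
  (G.bi.induce A).Connected

/-- The vertex set of a connected component of the bidirected graph induced on `A`. -/
def compSet (G : MixedGraph V) (A : Set V) (c : (G.bi.induce A).ConnectedComponent) : Set V :=
  Subtype.val '' c.supp

/-! ### Vertex orders and Markov blankets -/

/-- A strict total order of the vertices such that `x ≺ y` implies `y ∉ an(x)`. -/
structure IsConsistentVertexOrder (G : MixedGraph V) (lt : V → V → Prop) : Prop where
  isStrictTotalOrder : IsStrictTotalOrder V lt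
  consistent : ∀ x y, lt x y → y ∉ G.an {x}

/-- Ancestrally closed sets. -/
def AncestrallyClosed (G : MixedGraph V) (A : Set V) : Prop := G.an A = A

/-- The district of `x` in the subgraph induced on `A`: the vertices of `A` that are joined to `x`
by a path of bidirected edges in `A`. -/
def district (G : MixedGraph V) (A : Set V) (x : A) : Set V :=
  Subtype.val '' {y : A | (G.induce A).bi.Reachable x y}

/-- The Markov blanket of `x` with respect to the subgraph induced on `A`. -/
def mb (G : MixedGraph V) (A : Set V) (x : A) : Set V :=
  G.pa (G.district A x) ∪ (G.district A x \ {(x : V)})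

end MixedGraph

/-! ### Independence models -/

/-- An independence model: `I A B C` means `A ⫫ B | C`.  Only its values on triples of pairwise
disjoint sets with `A` and `B` nonempty are ever used. -/
abbrev IndependenceModel (V : Type u) := Set V → Set V → Set V → Prop

variable {V : Type u}

/-- Semi-graphoids.  `A`, `B`, `C`, `D` are disjoint, and only the conditioning set `C` may be
empty. -/
structure IsSemiGraphoid (I : IndependenceModel V) : Prop where
  symmetry : ∀ A B C : Set V, A.Nonempty → B.Nonempty →
    Disjoint A B → Disjoint A C → Disjoint B C → I A B C → I B A C
  decomposition : ∀ A B C D : Set V, A.Nonempty → B.Nonempty → D.Nonempty →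
    Disjoint A B → Disjoint A C → Disjoint A D → Disjoint B C → Disjoint B D → Disjoint C D →
    I A (B ∪ D) C → I A B C ∧ I A D C
  weakUnion : ∀ A B C D : Set V, A.Nonempty → B.Nonempty → D.Nonempty →
    Disjoint A B → Disjoint A C → Disjoint A D → Disjoint B C → Disjoint B D → Disjoint C D →
    I A (B ∪ D) C → I A B (D ∪ C) ∧ I A D (B ∪ C)
  contraction : ∀ A B C D : Set V, A.Nonempty → B.Nonempty → D.Nonempty →
    Disjoint A B → Disjoint A C → Disjoint A D → Disjoint B C → Disjoint B D → Disjoint C D →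
    ((I A B (D ∪ C) ∧ I A D C) ↔ I A (B ∪ D) C)

/-- The independence statement `A ⫫ B | C`, which is trivially true if `A` or `B` is empty. -/
def Indep (I : IndependenceModel V) (A B C : Set V) : Prop :=
  A.Nonempty → B.Nonempty → I A B C

/-- Joint independence `A₁ ⫫ ⋯ ⫫ Aᵣ | C`: each set is independent of the union of the others. -/
def MutuallyIndep (I : IndependenceModel V) {ι : Type u} (A : ι → Set V) (C : Set V) : Prop :=
  ∀ i, Indep I (A i) (⋃ j ∈ {j | j ≠ i}, A j) C

/-! ### The five Markov properties -/

/-- Global Markov property (m-separation). -/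
def GlobalMarkov (G : MixedGraph V) (I : IndependenceModel V) : Prop :=
  ∀ X Y Z : Set V, X.Nonempty → Y.Nonempty → Disjoint X Y → Disjoint X Z → Disjoint Y Z →
    G.MSeparated X Y Z → I X Y Z

/-- Global Markov property (m*-separation in the augmented graph). -/
def AugmentedGlobalMarkov (G : MixedGraph V) (I : IndependenceModel V) : Prop :=
  ∀ X Y Z : Set V, X.Nonempty → Y.Nonempty → Disjoint X Y → Disjoint X Z → Disjoint Y Z →
    G.MStarSeparated X Y Z → I X Y Z

/-- Block-recursive Markov property of type IV. -/
structure BlockRecursiveMarkov (G : MixedGraph V) (I : IndependenceModel V) : Prop where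
  iv0 : ∀ T : G.ChainComponent, Indep I T.supp (G.ndD T \ G.paD T) (G.paD T)
  iv1 : ∀ T : G.ChainComponent, ∀ A ⊆ T.supp, Indep I A (G.paD T \ G.pa A) (G.pa A)
  iv2 : ∀ T : G.ChainComponent, ∀ A ⊆ T.supp, G.ConnectedSet A →
    Indep I A (T.supp \ G.nb A) (G.paD T)

/-- Multivariate regression Markov property, for a given order of the chain components. -/
structure MRMarkov (G : MixedGraph V) (lt : G.ChainComponent → G.ChainComponent → Prop)
    (I : IndependenceModel V) : Prop where
  mr1 : ∀ T : G.ChainComponent, ∀ A ⊆ T.supp, G.ConnectedSet A →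
    Indep I A (G.pre lt T \ G.pa A) (G.pa A)
  mr2 : ∀ T : G.ChainComponent, ∀ A ⊆ T.supp, ¬ G.ConnectedSet A →
    MutuallyIndep I (G.compSet A) (G.pre lt T)

/-- Ordered local Markov property, for a given order of the vertices: for every vertex `x` and
every ancestrally closed set `A` with `x ∈ A` all of whose other elements precede `x`. -/
def OrderedLocalMarkov (G : MixedGraph V) (lt : V → V → Prop) (I : IndependenceModel V) : Prop :=
  ∀ (A : Set V) (x : A), G.AncestrallyClosed A → A ⊆ {v | lt v x ∨ v = x} →
    Indep I {(x : V)} (A \ (G.mb A x ∪ {(x : V)})) (G.mb A x)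

end MVR

/-! All separations are expressed by one relation.  For an ancestrally closed set `A`, two vertices
are collider linked in `A` if each of them lies in, or is a parent of, one common district of the
subgraph induced on `A`.  This is adjacency in the augmented graph of that subgraph, and
m-connecting walks between `X` and `Y` given `Z` translate into chains of such links in
`an(X ∪ Y ∪ Z)` that avoid `Z`: a run of colliders in `Z` becomes one link, and conversely a
collider that is not in `an(Z)` has a directed path to `X` or `Y`, along which the walk is rerouted.
Hence both global properties say that `X ⫫ Y | Z` whenever `X`, `Y`, `Z` partition an ancestrally
closed set without a link between `X` and `Y`.  By semi-graphoid calculus this partition property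
follows by removing one childless vertex `x` of `A` at a time, from the single statement that `x` is
independent of the rest of `A` given its Markov blanket.  The ordered local property is this
statement for the largest vertex of `A`; the multivariate regression property yields it for a vertex
of `A` in the smallest chain component. -/

namespace MVR

universe u

variable {V : Type u}

/-! ### Semi-graphoid calculus -/

section SemiGraphoid

variable {I : IndependenceModel V} {A A' B B' C C' D : Set V}

/-- The statement `A ⫫ B | C` together with the disjointness it presupposes.  Bundling the two
removes the side conditions from the semi-graphoid rules, which preserve disjointness. -/
structure DisjIndep (I : IndependenceModel V) (A B C : Set V) : Prop where
  disjoint : Disjoint A B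
  disjoint_left : Disjoint A C
  disjoint_right : Disjoint B C
  indep : Indep I A B C

namespace DisjIndep

theorem symm (h : DisjIndep I A B C) (hI : IsSemiGraphoid I) : DisjIndep I B A C where
  disjoint := h.disjoint.symm
  disjoint_left := h.disjoint_right
  disjoint_right := h.disjoint_left
  indep hB hA := hI.symmetry A B C hA hB h.disjoint h.disjoint_left h.disjoint_right (h.indep hA hB)

theorem of_union (h : DisjIndep I A (B ∪ D) C) (hI : IsSemiGraphoid I) (hBD : Disjoint B D) :
    DisjIndep I A B (D ∪ C) ∧ DisjIndep I A D C := by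
  obtain ⟨hAB, hAD⟩ := Set.disjoint_union_right.1 h.disjoint
  obtain ⟨hBC, hDC⟩ := Set.disjoint_union_left.1 h.disjoint_right
  have hAC := h.disjoint_left
  rcases B.eq_empty_or_nonempty with rfl | hB
  · rw [Set.empty_union] at h
    exact ⟨⟨hAB, hAD.union_right hAC, Set.empty_disjoint _, fun _ hB => absurd rfl hB.ne_empty⟩, h⟩
  rcases D.eq_empty_or_nonempty with rfl | hD
  · rw [Set.union_empty] at h
    exact ⟨by rwa [Set.empty_union], hAD, hAC, hDC, fun _ hD => absurd rfl hD.ne_empty⟩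
  have key (hA : A.Nonempty) : I A B (D ∪ C) ∧ I A D C :=
    (hI.contraction A B C D hA hB hD hAB hAC hAD hBC hBD hDC.symm).2 (h.indep hA (hB.inl))
  exact ⟨⟨hAB, hAD.union_right hAC, hBD.union_right hBC, fun hA _ => (key hA).1⟩,
    hAD, hAC, hDC, fun hA _ => (key hA).2⟩

theorem weakUnion (h : DisjIndep I A B C) (hI : IsSemiGraphoid I) (hB : B' ⊆ B) (hC : C ⊆ C')
    (hC' : C' ⊆ B ∪ C) (hBC : Disjoint B' C') : DisjIndep I A B' C' := by
  have hsplit : B = (B \ (B' ∪ C')) ∪ (B' ∪ C' \ C) := by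
    ext v
    have hBv := @hB v
    have hCv := @hC' v
    have hBCv : v ∈ B → v ∉ C := fun hv => Set.disjoint_left.1 h.disjoint_right hv
    simp only [Set.mem_union, Set.mem_sdiff] at hCv ⊢
    tauto
  rw [hsplit] at h
  have hdisj : Disjoint (B \ (B' ∪ C')) (B' ∪ C' \ C) :=
    Set.disjoint_sdiff_left.mono_right (Set.union_subset_union_right _ Set.sdiff_subset)
  have h' := ((h.of_union hI hdisj).2.of_union hI (hBC.mono_right Set.sdiff_subset)).1
  rwa [Set.sdiff_union_of_subset hC] at h'

theorem weakUnion_left (h : DisjIndep I A B C) (hI : IsSemiGraphoid I) (hA : A' ⊆ A) (hC : C ⊆ C')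
    (hC' : C' ⊆ A ∪ C) (hAC : Disjoint A' C') : DisjIndep I A' B C' :=
  ((h.symm hI).weakUnion hI hA hC hC' hAC).symm hI

theorem mono_right (h : DisjIndep I A B C) (hI : IsSemiGraphoid I) (hB : B' ⊆ B) :
    DisjIndep I A B' C :=
  h.weakUnion hI hB subset_rfl Set.subset_union_right (h.disjoint_right.mono_left hB)

theorem mono_left (h : DisjIndep I A B C) (hI : IsSemiGraphoid I) (hA : A' ⊆ A) :
    DisjIndep I A' B C :=
  ((h.symm hI).mono_right hI hA).symm hI

theorem contraction (h : DisjIndep I A B (D ∪ C)) (h' : DisjIndep I A D C) (hI : IsSemiGraphoid I) :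
    DisjIndep I A (B ∪ D) C := by
  obtain ⟨hBD, hBC⟩ := Set.disjoint_union_right.1 h.disjoint_right
  refine ⟨h.disjoint.union_right h'.disjoint, h'.disjoint_left,
    hBC.union_left h'.disjoint_right, fun hA _ => ?_⟩
  rcases B.eq_empty_or_nonempty with rfl | hB
  · rw [Set.empty_union] at *
    exact h'.indep hA ‹_›
  rcases D.eq_empty_or_nonempty with rfl | hD
  · rw [Set.union_empty]
    rw [Set.empty_union] at h
    exact h.indep hA hB
  exact (hI.contraction A B C D hA hB hD h.disjoint h'.disjoint_left h'.disjoint hBC hBD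
    h'.disjoint_right.symm).1 ⟨h.indep hA hB, h'.indep hA hD⟩

theorem contraction_left (h : DisjIndep I A B (D ∪ C)) (h' : DisjIndep I D B C)
    (hI : IsSemiGraphoid I) : DisjIndep I (A ∪ D) B C :=
  ((h.symm hI).contraction (h'.symm hI) hI).symm hI

end DisjIndep

end SemiGraphoid

/-! ### Districts and collider links -/

namespace MixedGraph

/-- The district of `x` in the subgraph induced on `A`, as a set of vertices of the whole graph.
Unlike in `district`, the vertex `x` is not required to lie in `A`. -/
def biDistrict (G : MixedGraph V) (A : Set V) (x : V) : Set V :=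
  {y | Relation.ReflTransGen (fun s t => s ∈ A ∧ t ∈ A ∧ G.bi.Adj s t) x y}

/-- The Markov blanket of `x` in the subgraph induced on `A`, with `x` itself added: the members
and the parents of the district of `x`. -/
def closedBlanket (G : MixedGraph V) (A : Set V) (x : V) : Set V :=
  {u | ∃ a ∈ G.biDistrict A x, u = a ∨ G.dir u a}

/-- `u` and `v` are members or parents of one and the same district of the subgraph induced on `A`.
For distinct vertices of an ancestrally closed `A` this is adjacency in the augmented graph. -/
def ColliderLinked (G : MixedGraph V) (A : Set V) (u v : V) : Prop :=
  ∃ a ∈ A, u ∈ G.closedBlanket A a ∧ v ∈ G.closedBlanket A a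

variable {G : MixedGraph V} {A B : Set V} {u v x y : V}

theorem ancestrallyClosed_iff : G.AncestrallyClosed A ↔ ∀ u v, G.dir u v → v ∈ A → u ∈ A := by
  refine ⟨fun h u v huv hv => h ▸ ⟨v, hv, .single huv⟩, fun h => ?_⟩
  refine Set.Subset.antisymm ?_ fun v hv => ⟨v, hv, .refl⟩
  rintro u ⟨v, hv, huv⟩
  induction huv using Relation.ReflTransGen.head_induction_on with
  | refl => exact hv
  | head h' _ ih => exact h _ _ h' ih

theorem ancestrallyClosed_an : G.AncestrallyClosed (G.an A) :=
  ancestrallyClosed_iff.2 fun _ _ huv ⟨w, hw, hvw⟩ => ⟨w, hw, hvw.head huv⟩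

theorem subset_an : A ⊆ G.an A := fun v hv => ⟨v, hv, .refl⟩

theorem an_mono (h : A ⊆ B) : G.an A ⊆ G.an B := fun _ ⟨b, hb, hab⟩ => ⟨b, h hb, hab⟩

theorem mem_biDistrict_self : x ∈ G.biDistrict A x := Relation.ReflTransGen.refl

theorem mem_biDistrict_symm (h : y ∈ G.biDistrict A x) : x ∈ G.biDistrict A y := by
  induction h with
  | refl => exact .refl
  | tail _ h ih => exact .head ⟨h.2.1, h.1, h.2.2.symm⟩ ih

theorem biDistrict_eq_of_mem (h : y ∈ G.biDistrict A x) : G.biDistrict A y = G.biDistrict A x :=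
  Set.ext fun _ => ⟨Relation.ReflTransGen.trans h,
    Relation.ReflTransGen.trans (mem_biDistrict_symm h)⟩

theorem biDistrict_subset (hx : x ∈ A) : G.biDistrict A x ⊆ A := fun y hy => by
  induction hy with
  | refl => exact hx
  | tail _ h _ => exact h.2.1

theorem biDistrict_mono (h : A ⊆ B) : G.biDistrict A x ⊆ G.biDistrict B x :=
  Relation.ReflTransGen.mono (fun _ _ hs => ⟨h hs.1, h hs.2.1, hs.2.2⟩) x

theorem mem_biDistrict_iff_reachable {x y : A} :
    (y : V) ∈ G.biDistrict A x ↔ (G.bi.induce A).Reachable x y := by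
  rw [SimpleGraph.reachable_iff_reflTransGen]
  refine ⟨fun h => ?_, Relation.ReflTransGen.lift Subtype.val
    (fun s t h => ⟨s.2, t.2, SimpleGraph.induce_adj.1 h⟩) x y⟩
  suffices key : ∀ z ∈ G.biDistrict A x, ∃ hz : z ∈ A,
      Relation.ReflTransGen (G.bi.induce A).Adj x ⟨z, hz⟩ from (key y h).2
  intro z hz
  induction hz with
  | refl => exact ⟨x.2, .refl⟩
  | tail _ h ih => exact ⟨h.2.1, ih.2.tail (SimpleGraph.induce_adj.2 h.2.2)⟩

theorem image_reachable_eq_biDistrict (x : A) :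
    Subtype.val '' {y : A | (G.bi.induce A).Reachable x y} = G.biDistrict A x := by
  ext y
  refine ⟨?_, fun h => ⟨⟨y, biDistrict_subset x.2 h⟩, mem_biDistrict_iff_reachable.1 h, rfl⟩⟩
  rintro ⟨z, hz, rfl⟩
  exact mem_biDistrict_iff_reachable.2 hz

theorem connectedSet_biDistrict : G.ConnectedSet (G.biDistrict A x) := by
  refine (SimpleGraph.connected_iff_exists_forall_reachable _).2
    ⟨⟨x, mem_biDistrict_self⟩, fun ⟨y, hy⟩ => ?_⟩
  induction hy with
  | refl => exact .refl _
  | tail _ h ih => exact ih.trans (SimpleGraph.Adj.reachable (SimpleGraph.induce_adj.2 h.2.2))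

theorem mem_closedBlanket_self : x ∈ G.closedBlanket A x := ⟨x, mem_biDistrict_self, .inl rfl⟩

theorem closedBlanket_mono (h : A ⊆ B) : G.closedBlanket A x ⊆ G.closedBlanket B x :=
  fun _ ⟨a, ha, hu⟩ => ⟨a, biDistrict_mono h ha, hu⟩

theorem closedBlanket_eq_of_mem (h : y ∈ G.biDistrict A x) :
    G.closedBlanket A y = G.closedBlanket A x := by
  rw [closedBlanket, closedBlanket, biDistrict_eq_of_mem h]

theorem closedBlanket_eq : G.closedBlanket A x = G.biDistrict A x ∪ G.pa (G.biDistrict A x) := by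
  ext u
  simp only [closedBlanket, pa, Set.mem_union, Set.mem_ofPred_eq]
  constructor
  · rintro ⟨a, ha, rfl | hua⟩
    · exact .inl ha
    · exact or_iff_not_imp_left.2 fun hu => ⟨hu, a, ha, hua⟩
  · rintro (hu | ⟨-, a, ha, hua⟩)
    · exact ⟨u, hu, .inl rfl⟩
    · exact ⟨a, ha, .inr hua⟩

theorem closedBlanket_subset (hA : G.AncestrallyClosed A) (hx : x ∈ A) :
    G.closedBlanket A x ⊆ A := by
  rintro u ⟨a, ha, rfl | hua⟩
  · exact biDistrict_subset hx ha
  · exact ancestrallyClosed_iff.1 hA _ _ hua (biDistrict_subset hx ha)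

theorem mb_eq (x : A) : G.mb A x = G.closedBlanket A x \ {(x : V)} := by
  have hx : (x : V) ∉ G.pa (G.biDistrict A x) := fun h => h.1 mem_biDistrict_self
  rw [mb, show G.district A x = G.biDistrict A x from image_reachable_eq_biDistrict x,
    closedBlanket_eq, Set.union_sdiff_distrib, Set.sdiff_singleton_eq_self hx, Set.union_comm]

theorem ColliderLinked.mono (h : A ⊆ B) (huv : G.ColliderLinked A u v) :
    G.ColliderLinked B u v :=
  let ⟨a, ha, hu, hv⟩ := huv
  ⟨a, h ha, closedBlanket_mono h hu, closedBlanket_mono h hv⟩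

theorem ColliderLinked.symm (h : G.ColliderLinked A u v) : G.ColliderLinked A v u :=
  let ⟨a, ha, hu, hv⟩ := h
  ⟨a, ha, hv, hu⟩

theorem ColliderLinked.mem_closedBlanket (hu : ∀ w ∈ A, ¬ G.dir u w)
    (h : G.ColliderLinked A u v) : v ∈ G.closedBlanket A u := by
  obtain ⟨a, ha, ⟨b, hb, rfl | hub⟩, hv⟩ := h
  · rwa [closedBlanket_eq_of_mem hb]
  · exact absurd hub (hu b (biDistrict_subset ha hb))

theorem ColliderLinked.mem_union_pa {X : Set V} (hdir : ∀ u ∈ X, ∀ w ∈ A, ¬ G.dir u w)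
    (hbi : ∀ u ∈ X, ∀ w ∈ A, G.bi.Adj u w → w ∈ X) (hu : u ∈ X) (h : G.ColliderLinked A u v) :
    v ∈ X ∪ G.pa X := by
  have hX : G.biDistrict A u ⊆ X := fun y hy => by
    induction hy with
    | refl => exact hu
    | tail _ h ih => exact hbi _ ih _ h.2.1 h.2.2
  obtain ⟨a, ha, rfl | hva⟩ := h.mem_closedBlanket (hdir u hu)
  · exact .inl (hX ha)
  · exact or_iff_not_imp_left.2 fun hv => ⟨hv, a, hX ha, hva⟩

end MixedGraph

open MixedGraph

/-! ### Partitions of ancestrally closed sets -/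

section PartitionMarkov

variable {G : MixedGraph V} {I : IndependenceModel V} {A X Y Z : Set V} {x : V}

/-- A partition of `A` into `X`, `Y`, `Z` such that no vertex of `X` is collider linked in `A` to a
vertex of `Y`. -/
structure IsUnlinkedPartition (G : MixedGraph V) (A X Y Z : Set V) : Prop where
  union_eq : X ∪ Y ∪ Z = A
  disjoint : Disjoint X Y
  disjoint_left : Disjoint X Z
  disjoint_right : Disjoint Y Z
  not_colliderLinked : ∀ u ∈ X, ∀ v ∈ Y, ¬ G.ColliderLinked A u v

/-- The Markov property for unlinked partitions of ancestrally closed sets, through which the five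
properties of the theorem are compared. -/
def PartitionMarkov (G : MixedGraph V) (I : IndependenceModel V) : Prop :=
  ∀ A, G.AncestrallyClosed A → ∀ X Y Z, IsUnlinkedPartition G A X Y Z → DisjIndep I X Y Z

theorem IsUnlinkedPartition.symm (h : IsUnlinkedPartition G A X Y Z) :
    IsUnlinkedPartition G A Y X Z where
  union_eq := by rw [Set.union_comm Y, h.union_eq]
  disjoint := h.disjoint.symm
  disjoint_left := h.disjoint_right
  disjoint_right := h.disjoint_left
  not_colliderLinked u hu v hv huv := h.not_colliderLinked v hv u hu huv.symm

theorem IsUnlinkedPartition.erase (h : IsUnlinkedPartition G A X Y Z) :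
    IsUnlinkedPartition G (A \ {x}) (X \ {x}) (Y \ {x}) (Z \ {x}) where
  union_eq := by rw [← h.union_eq, Set.union_sdiff_distrib, Set.union_sdiff_distrib]
  disjoint := h.disjoint.mono Set.sdiff_subset Set.sdiff_subset
  disjoint_left := h.disjoint_left.mono Set.sdiff_subset Set.sdiff_subset
  disjoint_right := h.disjoint_right.mono Set.sdiff_subset Set.sdiff_subset
  not_colliderLinked u hu v hv huv :=
    h.not_colliderLinked u hu.1 v hv.1 (huv.mono Set.sdiff_subset)

theorem IsUnlinkedPartition.indep_of_disjoint_closedBlanket (hI : IsSemiGraphoid I)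
    (h : IsUnlinkedPartition G A X Y Z) (hA : G.AncestrallyClosed A) (hxA : x ∈ A)
    (hY : Disjoint Y (G.closedBlanket A x))
    (hx : DisjIndep I {x} (A \ G.closedBlanket A x) (G.closedBlanket A x \ {x}))
    (hrest : DisjIndep I (X \ {x}) (Y \ {x}) (Z \ {x})) : DisjIndep I X Y Z := by
  have hYA : Y ⊆ A := h.union_eq ▸ Set.subset_union_right.trans Set.subset_union_left
  have hxY : x ∉ Y := fun hxY => Set.disjoint_left.1 hY hxY mem_closedBlanket_self
  have hxY' : DisjIndep I {x} Y ((A \ Y) \ {x}) := by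
    refine hx.weakUnion hI (Set.subset_sdiff.2 ⟨hYA, hY⟩) ?_ ?_
      (Set.disjoint_sdiff_right.mono_right Set.sdiff_subset)
    · exact Set.sdiff_subset_sdiff_left
        (Set.subset_sdiff.2 ⟨closedBlanket_subset hA hxA, hY.symm⟩)
    · intro v hv
      by_cases hvx : v ∈ G.closedBlanket A x
      · exact .inr ⟨hvx, hv.2⟩
      · exact .inl ⟨hv.1.1, hvx⟩
  have hAY : A \ Y = X ∪ Z := by
    rw [← h.union_eq, Set.union_right_comm, Set.union_sdiff_cancel_right]
    exact Set.disjoint_iff.1 (Set.disjoint_union_left.2 ⟨h.disjoint, h.disjoint_right.symm⟩)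
  rw [hAY, Set.union_sdiff_distrib] at hxY'
  rw [Set.sdiff_singleton_eq_self hxY] at hrest
  refine (hxY'.contraction_left hrest hI).weakUnion_left hI ?_ Set.sdiff_subset ?_ h.disjoint_left
  · exact Set.subset_union_right.trans Set.union_sdiff_self.symm.subset
  · rw [Set.union_sdiff_self]
    intro v hv
    by_cases hvx : v ∈ ({x} : Set V)
    · exact .inl (.inl hvx)
    · exact .inr ⟨hv, hvx⟩

theorem partitionMarkov_of_local [Finite V] (hI : IsSemiGraphoid I)
    (hlocal : ∀ A, G.AncestrallyClosed A → A.Nonempty → ∃ x ∈ A, (∀ w ∈ A, ¬ G.dir x w) ∧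
      DisjIndep I {x} (A \ G.closedBlanket A x) (G.closedBlanket A x \ {x})) :
    PartitionMarkov G I := by
  intro A hA
  induction A using WellFoundedLT.induction with
  | ind A ih =>
    intro X Y Z h
    rcases A.eq_empty_or_nonempty with rfl | hne
    · have hX : X = ∅ := Set.subset_empty_iff.1
        (h.union_eq ▸ Set.subset_union_left.trans Set.subset_union_left)
      exact ⟨h.disjoint, h.disjoint_left, h.disjoint_right, fun hX' => absurd hX hX'.ne_empty⟩
    obtain ⟨x, hxA, hchild, hx⟩ := hlocal A hA hne
    have herase : G.AncestrallyClosed (A \ {x}) := ancestrallyClosed_iff.2 fun u v huv hv =>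
      ⟨ancestrallyClosed_iff.1 hA u v huv hv.1, by rintro rfl; exact hchild v hv.1 huv⟩
    have hrest := ih _ (Set.sdiff_singleton_ssubset.2 hxA) herase _ _ _ h.erase
    by_cases hY : Disjoint Y (G.closedBlanket A x)
    · exact h.indep_of_disjoint_closedBlanket hI hA hxA hY hx hrest
    · refine (h.symm.indep_of_disjoint_closedBlanket hI hA hxA ?_ hx (hrest.symm hI)).symm hI
      obtain ⟨v, hvY, hv⟩ := Set.not_disjoint_iff.1 hY
      exact Set.disjoint_left.2 fun u huX hu => h.not_colliderLinked u huX v hvY ⟨x, hxA, hu, hv⟩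

end PartitionMarkov

/-! ### Chain components -/

section ChainComponents

variable {G : MixedGraph V} {I : IndependenceModel V}
  {lt : G.ChainComponent → G.ChainComponent → Prop} {T T' : G.ChainComponent}
  {A W X Z : Set V} {u v x : V}

namespace MixedGraph

theorem mem_pre_iff : v ∈ G.pre lt T ↔ lt T (G.bi.connectedComponentMk v) := by
  simp [pre]

theorem mem_paD_iff : v ∈ G.paD T ↔ G.compDir (G.bi.connectedComponentMk v) T := by
  simp [paD]

theorem mem_ndD_iff :
    v ∈ G.ndD T ↔ ¬ Relation.ReflTransGen G.compDir T (G.bi.connectedComponentMk v) := by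
  simp [ndD]

theorem compDir_of_dir (h : G.dir u v) :
    G.compDir (G.bi.connectedComponentMk u) (G.bi.connectedComponentMk v) :=
  ⟨u, rfl, v, rfl, h⟩

theorem reflTransGen_of_mem_supp (hu : u ∈ T.supp) (hv : v ∈ T.supp) :
    Relation.ReflTransGen (fun a b => G.dir a b ∨ G.bi.Adj a b) u v := by
  have huv : G.bi.Reachable u v := SimpleGraph.ConnectedComponent.exact (hu.trans hv.symm)
  exact Relation.ReflTransGen.mono (fun _ _ => Or.inr) _ _
    ((SimpleGraph.reachable_iff_reflTransGen _ _).1 huv)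

theorem reflTransGen_of_reflTransGen_compDir (h : Relation.ReflTransGen G.compDir T T')
    (hu : u ∈ T.supp) (hv : v ∈ T'.supp) :
    Relation.ReflTransGen (fun a b => G.dir a b ∨ G.bi.Adj a b) u v := by
  induction h generalizing v with
  | refl => exact reflTransGen_of_mem_supp hu hv
  | tail _ h ih =>
    obtain ⟨a, ha, b, hb, hab⟩ := h
    exact ((ih ha).tail (.inl hab)).trans (reflTransGen_of_mem_supp hb hv)

theorem IsMVRChainGraph.not_reflTransGen_compDir (hG : G.IsMVRChainGraph) (h : G.compDir T T') :
    ¬ Relation.ReflTransGen G.compDir T' T := by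
  obtain ⟨u, hu, v, hv, huv⟩ := h
  exact fun h' => hG u v huv (reflTransGen_of_reflTransGen_compDir h' hv hu)

theorem IsMVRChainGraph.paD_subset_ndD (hG : G.IsMVRChainGraph) : G.paD T ⊆ G.ndD T :=
  fun _ hv => mem_ndD_iff.2 (hG.not_reflTransGen_compDir (mem_paD_iff.1 hv))

theorem disjoint_supp_ndD : Disjoint T.supp (G.ndD T) :=
  Set.disjoint_left.2 fun v hv hv' => mem_ndD_iff.1 hv' (by rw [show _ = T from hv])

theorem mem_ndD_of_dir (h : G.dir u v) (hv : v ∈ G.ndD T) : u ∈ G.ndD T :=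
  mem_ndD_iff.2 fun hu => mem_ndD_iff.1 hv (hu.tail (compDir_of_dir h))

theorem mem_paD_of_dir (h : G.dir u v) (hv : v ∈ T.supp) : u ∈ G.paD T :=
  mem_paD_iff.2 ((show _ = T from hv) ▸ compDir_of_dir h)

theorem pa_subset_paD (hA : A ⊆ T.supp) : G.pa A ⊆ G.paD T := by
  rintro u ⟨_, v, hv, huv⟩
  exact mem_paD_of_dir huv (hA hv)

theorem disjoint_pa : Disjoint A (G.pa A) := Set.disjoint_left.2 fun _ hv h => h.1 hv

theorem mem_supp_of_adj (h : G.bi.Adj u v) (hu : u ∈ T.supp) : v ∈ T.supp :=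
  (SimpleGraph.ConnectedComponent.sound h.reachable.symm).trans hu

theorem IsConsistentCompOrder.lt_of_compDir (hlt : G.IsConsistentCompOrder lt)
    (hG : G.IsMVRChainGraph) (h : G.compDir T T') : lt T' T := by
  have := hlt.isStrictTotalOrder
  rcases trichotomous_of lt T T' with h' | rfl | h'
  · exact absurd h (hlt.consistent _ _ h')
  · exact absurd .refl (hG.not_reflTransGen_compDir h)
  · exact h'

theorem IsConsistentCompOrder.eq_or_lt_of_reflTransGen (hlt : G.IsConsistentCompOrder lt)
    (hG : G.IsMVRChainGraph) (h : Relation.ReflTransGen G.compDir T T') : T' = T ∨ lt T' T := by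
  have := hlt.isStrictTotalOrder
  induction h with
  | refl => exact .inl rfl
  | tail _ h ih =>
    rcases ih with rfl | ih
    · exact .inr (hlt.lt_of_compDir hG h)
    · exact .inr (_root_.trans (hlt.lt_of_compDir hG h) ih)

theorem IsConsistentCompOrder.pre_subset_ndD (hlt : G.IsConsistentCompOrder lt)
    (hG : G.IsMVRChainGraph) : G.pre lt T ⊆ G.ndD T := by
  have := hlt.isStrictTotalOrder
  refine fun v hv => mem_ndD_iff.2 fun hr => ?_
  rw [mem_pre_iff] at hv
  rcases hlt.eq_or_lt_of_reflTransGen hG hr with e | hl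
  · exact irrefl_of lt T (e ▸ hv)
  · exact asymm_of lt hl hv

theorem IsConsistentCompOrder.paD_subset_pre (hlt : G.IsConsistentCompOrder lt)
    (hG : G.IsMVRChainGraph) : G.paD T ⊆ G.pre lt T :=
  fun _ hv => mem_pre_iff.2 (hlt.lt_of_compDir hG (mem_paD_iff.1 hv))

theorem IsConsistentCompOrder.disjoint_supp_pre (hlt : G.IsConsistentCompOrder lt)
    (hG : G.IsMVRChainGraph) : Disjoint T.supp (G.pre lt T) :=
  disjoint_supp_ndD.mono_right (hlt.pre_subset_ndD hG)

theorem biDistrict_inter_supp (hx : x ∈ T.supp) :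
    G.biDistrict (A ∩ T.supp) x = G.biDistrict A x := by
  refine (biDistrict_mono Set.inter_subset_left).antisymm fun y hy => ?_
  suffices y ∈ T.supp ∧ y ∈ G.biDistrict (A ∩ T.supp) x from this.2
  induction hy with
  | refl => exact ⟨hx, mem_biDistrict_self⟩
  | tail _ h ih =>
    have hT := mem_supp_of_adj h.2.2 ih.1
    exact ⟨hT, ih.2.tail ⟨⟨h.1, ih.1⟩, ⟨h.2.1, hT⟩, h.2.2⟩⟩

theorem compSet_connectedComponentMk (x : A) :
    G.compSet A ((G.bi.induce A).connectedComponentMk x) = G.biDistrict A x := by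
  rw [← image_reachable_eq_biDistrict, compSet]
  congr 1
  ext y
  exact SimpleGraph.ConnectedComponent.eq.trans SimpleGraph.reachable_comm

theorem biDistrict_eq_of_connectedSet (hA : G.ConnectedSet A) (hx : x ∈ A) :
    G.biDistrict A x = A :=
  (biDistrict_subset hx).antisymm fun y hy =>
    mem_biDistrict_iff_reachable.2 (hA.preconnected ⟨x, hx⟩ ⟨y, hy⟩)

end MixedGraph

theorem mutuallyIndep_compSet_iff :
    MutuallyIndep I (G.compSet A) Z ↔
      ∀ x ∈ A, Indep I (G.biDistrict A x) (A \ G.biDistrict A x) Z := by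
  have hunion (x : A) : ⋃ c ∈ {c | c ≠ (G.bi.induce A).connectedComponentMk x}, G.compSet A c =
      A \ G.biDistrict A x := by
    ext y
    simp only [Set.mem_iUnion, Set.mem_sdiff]
    constructor
    · rintro ⟨c, hc, z, rfl, rfl⟩
      exact ⟨z.2, fun hz => hc (SimpleGraph.ConnectedComponent.sound
        (mem_biDistrict_iff_reachable.1 hz).symm)⟩
    · rintro ⟨hy, hyx⟩
      exact ⟨_, fun hc => hyx (mem_biDistrict_iff_reachable (y := ⟨y, hy⟩).2
        (SimpleGraph.ConnectedComponent.exact hc).symm), ⟨y, hy⟩, rfl, rfl⟩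
  refine ⟨fun h x hx => ?_, fun h c => ?_⟩
  · rw [← hunion ⟨x, hx⟩, ← compSet_connectedComponentMk ⟨x, hx⟩]
    exact h _
  · induction c using SimpleGraph.ConnectedComponent.ind with
    | h x =>
      rw [hunion, compSet_connectedComponentMk]
      exact h x x.2

/-! ### The block-recursive and the multivariate regression Markov property -/

theorem PartitionMarkov.disjIndep_block (hP : PartitionMarkov G I) (hG : G.IsMVRChainGraph)
    (hX : X ⊆ T.supp) (hW : W ⊆ T.supp) (hXW : Disjoint X W)
    (hadj : ∀ u ∈ X, ∀ v ∈ W, ¬ G.bi.Adj u v) (hpa : G.pa X ⊆ Z) (hZ : Z ⊆ G.ndD T) :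
    DisjIndep I X (W ∪ G.ndD T \ Z) Z := by
  have hXnd : Disjoint X (G.ndD T) := disjoint_supp_ndD.mono_left hX
  have hWnd : Disjoint W (G.ndD T) := disjoint_supp_ndD.mono_left hW
  have hclosed : G.AncestrallyClosed (X ∪ W ∪ G.ndD T) := by
    refine ancestrallyClosed_iff.2 fun u v huv hv => .inr ?_
    rcases hv with hv | hv
    · exact hG.paD_subset_ndD (mem_paD_of_dir huv (Set.union_subset hX hW hv))
    · exact mem_ndD_of_dir huv hv
  have hdir (u) (hu : u ∈ X) (w) (hw : w ∈ X ∪ W ∪ G.ndD T) : ¬ G.dir u w := fun huw =>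
    Set.disjoint_left.1 hXnd hu <| hw.elim
      (fun hw => hG.paD_subset_ndD (mem_paD_of_dir huw (Set.union_subset hX hW hw)))
      (mem_ndD_of_dir huw)
  have hbi (u) (hu : u ∈ X) (w) (hw : w ∈ X ∪ W ∪ G.ndD T) (huw : G.bi.Adj u w) : w ∈ X := by
    rcases hw with (hw | hw) | hw
    · exact hw
    · exact absurd huw (hadj u hu w hw)
    · exact absurd hw (Set.disjoint_left.1 disjoint_supp_ndD (mem_supp_of_adj huw (hX hu)))
  have hdisj : Disjoint (W ∪ G.ndD T \ Z) (X ∪ G.pa X) :=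
    Set.disjoint_union_right.2 ⟨(hXW.union_right (hXnd.mono_right Set.sdiff_subset)).symm,
      ((hWnd.mono_right hZ).union_left Set.disjoint_sdiff_left).mono_right hpa⟩
  refine hP _ hclosed _ _ _ ⟨?_, hXW.union_right (hXnd.mono_right Set.sdiff_subset),
    hXnd.mono_right hZ, (hWnd.mono_right hZ).union_left Set.disjoint_sdiff_left,
    fun u hu v hv huv => Set.disjoint_left.1 hdisj hv (huv.mem_union_pa hdir hbi hu)⟩
  rw [← Set.union_assoc, Set.union_assoc, Set.sdiff_union_of_subset hZ]

theorem PartitionMarkov.blockRecursive (hP : PartitionMarkov G I) (hI : IsSemiGraphoid I)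
    (hG : G.IsMVRChainGraph) : BlockRecursiveMarkov G I where
  iv0 T := ((hP.disjIndep_block hG subset_rfl (Set.empty_subset _) (Set.disjoint_empty _)
    (fun _ _ _ hv => hv.elim) (pa_subset_paD subset_rfl) hG.paD_subset_ndD).mono_right hI
    Set.subset_union_right).indep
  iv1 T A hA := by
    have hpa := (pa_subset_paD hA).trans hG.paD_subset_ndD
    exact ((hP.disjIndep_block hG hA (Set.empty_subset _) (Set.disjoint_empty _)
      (fun _ _ _ hv => hv.elim) subset_rfl hpa).mono_right hI
      ((Set.sdiff_subset_sdiff_left hG.paD_subset_ndD).trans Set.subset_union_right)).indep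
  iv2 T A hA _ := ((hP.disjIndep_block hG hA Set.sdiff_subset
    (Set.disjoint_sdiff_right.mono_left Set.subset_union_left)
    (fun u hu v (hv : v ∈ T.supp \ G.nb A) huv => hv.2 (.inr ⟨u, hu, huv.symm⟩)) (pa_subset_paD hA)
    hG.paD_subset_ndD).mono_right hI Set.subset_union_left).indep

namespace BlockRecursiveMarkov

theorem disjIndep_iv0 (h : BlockRecursiveMarkov G I) (hG : G.IsMVRChainGraph) :
    DisjIndep I T.supp (G.ndD T \ G.paD T) (G.paD T) where
  disjoint := disjoint_supp_ndD.mono_right Set.sdiff_subset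
  disjoint_left := disjoint_supp_ndD.mono_right hG.paD_subset_ndD
  disjoint_right := Set.disjoint_sdiff_left
  indep := h.iv0 T

theorem disjIndep_iv1 (h : BlockRecursiveMarkov G I) (hG : G.IsMVRChainGraph) (hA : A ⊆ T.supp) :
    DisjIndep I A (G.paD T \ G.pa A) (G.pa A) where
  disjoint := disjoint_supp_ndD.mono hA (Set.sdiff_subset.trans hG.paD_subset_ndD)
  disjoint_left := disjoint_pa
  disjoint_right := Set.disjoint_sdiff_left
  indep := h.iv1 T A hA

theorem disjIndep_iv2 (h : BlockRecursiveMarkov G I) (hG : G.IsMVRChainGraph) (hA : A ⊆ T.supp)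
    (hconn : G.ConnectedSet A) : DisjIndep I A (T.supp \ G.nb A) (G.paD T) where
  disjoint := Set.disjoint_sdiff_right.mono_left Set.subset_union_left
  disjoint_left := disjoint_supp_ndD.mono hA hG.paD_subset_ndD
  disjoint_right := disjoint_supp_ndD.mono Set.sdiff_subset hG.paD_subset_ndD
  indep := h.iv2 T A hA hconn

theorem disjIndep_ndD (h : BlockRecursiveMarkov G I) (hI : IsSemiGraphoid I)
    (hG : G.IsMVRChainGraph) (hA : A ⊆ T.supp) : DisjIndep I A (G.ndD T \ G.pa A) (G.pa A) := by
  have h₀ := (h.disjIndep_iv0 hG).mono_left hI hA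
  rw [← Set.sdiff_union_of_subset (pa_subset_paD hA)] at h₀
  have h₁ := h₀.contraction (h.disjIndep_iv1 hG hA) hI
  rw [Set.sdiff_union_of_subset (pa_subset_paD hA)] at h₁
  refine h₁.mono_right hI fun v hv => ?_
  by_cases hvT : v ∈ G.paD T
  · exact .inr ⟨hvT, hv.2⟩
  · exact .inl ⟨hv.1, hvT⟩

theorem disjIndep_biDistrict (h : BlockRecursiveMarkov G I) (hI : IsSemiGraphoid I)
    (hG : G.IsMVRChainGraph) (hA : A ⊆ T.supp) (hx : x ∈ A) (hZ : G.paD T ⊆ Z)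
    (hZ' : Z ⊆ G.ndD T) : DisjIndep I (G.biDistrict A x) (A \ G.biDistrict A x) Z := by
  have hd : G.biDistrict A x ⊆ A := biDistrict_subset hx
  have hnb : A \ G.biDistrict A x ⊆ T.supp \ G.nb (G.biDistrict A x) := by
    rintro v ⟨hvA, hvd⟩
    refine ⟨hA hvA, ?_⟩
    rintro (hv | ⟨w, hw, hvw⟩)
    · exact hvd hv
    · exact hvd (hw.tail ⟨hd hw, hvA, hvw.symm⟩)
  have h₂ := (h.disjIndep_iv2 hG (hd.trans hA) connectedSet_biDistrict).mono_right hI hnb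
  have h₀ : DisjIndep I (G.biDistrict A x) (G.ndD T \ G.paD T)
      (A \ G.biDistrict A x ∪ G.paD T) :=
    (h.disjIndep_iv0 hG).weakUnion_left hI (hd.trans hA) Set.subset_union_right
      (Set.union_subset_union_left _ (Set.sdiff_subset.trans hA))
      (Set.disjoint_sdiff_right.union_right h₂.disjoint_left)
  refine (h₀.contraction h₂ hI).weakUnion hI Set.subset_union_right hZ (fun v hv => ?_)
    (disjoint_supp_ndD.mono (Set.sdiff_subset.trans hA) hZ')
  by_cases hvT : v ∈ G.paD T
  · exact .inr hvT
  · exact .inl (.inl ⟨hZ' hv, hvT⟩)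

theorem mrMarkov (h : BlockRecursiveMarkov G I) (hI : IsSemiGraphoid I) (hG : G.IsMVRChainGraph)
    (hlt : G.IsConsistentCompOrder lt) : MRMarkov G lt I where
  mr1 _ _ hA _ := ((h.disjIndep_ndD hI hG hA).mono_right hI
    (Set.sdiff_subset_sdiff_left (hlt.pre_subset_ndD hG))).indep
  mr2 _ _ hA _ := mutuallyIndep_compSet_iff.2 fun _ hx => (h.disjIndep_biDistrict hI hG hA hx
    (hlt.paD_subset_pre hG) (hlt.pre_subset_ndD hG)).indep

end BlockRecursiveMarkov

namespace MRMarkov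

theorem disjIndep_pre (h : MRMarkov G lt I) (hG : G.IsMVRChainGraph)
    (hlt : G.IsConsistentCompOrder lt) (hA : A ⊆ T.supp) (hconn : G.ConnectedSet A) :
    DisjIndep I A (G.pre lt T \ G.pa A) (G.pa A) where
  disjoint := (hlt.disjoint_supp_pre hG).mono hA Set.sdiff_subset
  disjoint_left := disjoint_pa
  disjoint_right := Set.disjoint_sdiff_left
  indep := h.mr1 T A hA hconn

theorem disjIndep_biDistrict (h : MRMarkov G lt I) (hG : G.IsMVRChainGraph)
    (hlt : G.IsConsistentCompOrder lt) (hA : A ⊆ T.supp) (hx : x ∈ A) :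
    DisjIndep I (G.biDistrict A x) (A \ G.biDistrict A x) (G.pre lt T) where
  disjoint := Set.disjoint_sdiff_right
  disjoint_left := (hlt.disjoint_supp_pre hG).mono_left ((biDistrict_subset hx).trans hA)
  disjoint_right := (hlt.disjoint_supp_pre hG).mono_left (Set.sdiff_subset.trans hA)
  indep := by
    by_cases hconn : G.ConnectedSet A
    · rw [biDistrict_eq_of_connectedSet hconn hx, Set.sdiff_self]
      exact fun _ h => absurd rfl h.ne_empty
    · exact mutuallyIndep_compSet_iff.1 (h.mr2 T A hA hconn) x hx

theorem disjIndep_closedBlanket (h : MRMarkov G lt I) (hI : IsSemiGraphoid I)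
    (hG : G.IsMVRChainGraph) (hlt : G.IsConsistentCompOrder lt) (hA : A ⊆ T.supp ∪ G.pre lt T)
    (hx : x ∈ A ∩ T.supp) :
    DisjIndep I {x} (A \ G.closedBlanket A x) (G.closedBlanket A x \ {x}) := by
  have hd : G.biDistrict A x ⊆ T.supp :=
    biDistrict_inter_supp (A := A) hx.2 ▸ (biDistrict_subset hx).trans Set.inter_subset_right
  have hpa : G.pa (G.biDistrict A x) ⊆ G.pre lt T :=
    (pa_subset_paD hd).trans (hlt.paD_subset_pre hG)
  have h₂ := h.disjIndep_biDistrict hG hlt Set.inter_subset_right hx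
  rw [biDistrict_inter_supp hx.2, ← Set.sdiff_union_of_subset hpa] at h₂
  have h₁ := h₂.contraction (h.disjIndep_pre hG hlt hd connectedSet_biDistrict) hI
  have hxpa : x ∉ G.pa (G.biDistrict A x) := fun hx => hx.1 mem_biDistrict_self
  rw [closedBlanket_eq]
  refine (h₁.mono_right hI fun v hv => ?_).weakUnion_left hI
    (Set.singleton_subset_iff.2 mem_biDistrict_self)
    (Set.subset_sdiff_singleton Set.subset_union_right hxpa) Set.sdiff_subset
    Set.disjoint_sdiff_right
  rcases hA hv.1 with hvT | hvpre
  · exact .inl ⟨⟨hv.1, hvT⟩, fun hvd => hv.2 (.inl hvd)⟩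
  · exact .inr ⟨hvpre, fun hvpa => hv.2 (.inr hvpa)⟩

theorem partitionMarkov [Finite V] (h : MRMarkov G lt I) (hI : IsSemiGraphoid I)
    (hG : G.IsMVRChainGraph) (hlt : G.IsConsistentCompOrder lt) : PartitionMarkov G I := by
  have := hlt.isStrictTotalOrder
  refine partitionMarkov_of_local hI fun A _ hne => ?_
  obtain ⟨_, ⟨x, hxA, rfl⟩, hmin⟩ := (Finite.wellFounded_of_trans_of_irrefl lt).has_min
    (G.bi.connectedComponentMk '' A) (hne.image _)
  have hA : A ⊆ (G.bi.connectedComponentMk x).supp ∪ G.pre lt (G.bi.connectedComponentMk x) := by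
    intro v hv
    rcases trichotomous_of lt (G.bi.connectedComponentMk x) (G.bi.connectedComponentMk v)
      with h | h | h
    · exact .inr (mem_pre_iff.2 h)
    · exact .inl h.symm
    · exact absurd h (hmin _ ⟨v, hv, rfl⟩)
  refine ⟨x, hxA, fun w hw hxw => hmin _ ⟨w, hw, rfl⟩ (hlt.lt_of_compDir hG (compDir_of_dir hxw)),
    h.disjIndep_closedBlanket hI hG hlt hA ⟨hxA, rfl⟩⟩

end MRMarkov

end ChainComponents

/-! ### Walks with a condition at every inner vertex -/

section Walks

variable {W : Type u} {H : SimpleGraph W} {R : W → W → W → Prop} {a b c u v : W}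

/-- `R` holds at every inner vertex of the walk, applied to its predecessor, the vertex itself and
its successor.  Both collider connection and m-connection are of this form. -/
def InnerForall (R : W → W → W → Prop) (p : H.Walk a b) : Prop :=
  ∀ i, i + 2 ≤ p.length → R (p.getVert i) (p.getVert (i + 1)) (p.getVert (i + 2))

theorem innerForall_nil : InnerForall R (.nil : H.Walk a a) := fun i hi => by
  simp only [SimpleGraph.Walk.length_nil] at hi
  omega

theorem innerForall_cons {h : H.Adj u v} {p : H.Walk v b} :
    InnerForall R (.cons h p) ↔ InnerForall R p ∧ (¬ p.Nil → R u v p.snd) := by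
  constructor
  · refine fun hp => ⟨fun i hi => ?_, fun hn => ?_⟩
    · exact hp (i + 1) (by rw [SimpleGraph.Walk.length_cons]; omega)
    · have := SimpleGraph.Walk.not_nil_iff_lt_length.1 hn
      simpa using hp 0 (by rw [SimpleGraph.Walk.length_cons]; omega)
  · rintro ⟨hp, hn⟩ (_ | i) hi
    · rw [SimpleGraph.Walk.length_cons] at hi
      simpa using hn (SimpleGraph.Walk.not_nil_iff_lt_length.2 (by omega))
    · exact hp i (by rw [SimpleGraph.Walk.length_cons] at hi; omega)

theorem innerForall_append {p : H.Walk a b} {q : H.Walk b c} :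
    InnerForall R (p.append q) ↔
      InnerForall R p ∧ InnerForall R q ∧ (¬ p.Nil → ¬ q.Nil → R p.penultimate b q.snd) := by
  induction p with
  | nil => simp [innerForall_nil]
  | cons h p ih =>
    rw [SimpleGraph.Walk.cons_append, innerForall_cons, innerForall_cons, ih]
    cases p with
    | nil => simp [innerForall_nil]
    | cons h' p =>
      simp only [SimpleGraph.Walk.not_nil_cons, not_false_eq_true, forall_const,
        SimpleGraph.Walk.cons_append, SimpleGraph.Walk.getVert_cons_succ,
        SimpleGraph.Walk.getVert_zero, SimpleGraph.Walk.penultimate_cons_cons]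
      tauto

/-- If `R` survives cutting out a closed subwalk, walks can be shortened to paths.  The last clause
lets the induction prepend an edge. -/
theorem InnerForall.exists_isPath
    (hcut : ∀ {u a w : W} (c : H.Walk a a), ¬ c.Nil → InnerForall R c → R u a c.snd →
      R c.penultimate a w → R u a w) {p : H.Walk a b} (hp : InnerForall R p) :
    ∃ q : H.Walk a b, q.IsPath ∧ InnerForall R q ∧
      ∀ t, (¬ p.Nil → R t a p.snd) → ¬ q.Nil → R t a q.snd := by
  classical
  induction p with
  | nil => exact ⟨.nil, .nil, hp, fun _ h => h⟩
  | @cons u v b h p ih =>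
    obtain ⟨hp, huv⟩ := innerForall_cons.1 hp
    obtain ⟨q, hq, hqR, hqt⟩ := ih hp
    have hcons : InnerForall R (.cons h q) := innerForall_cons.2 ⟨hqR, hqt u huv⟩
    by_cases hu : u ∈ q.support
    · have hsplit := q.take_spec hu
      rw [← hsplit, ← SimpleGraph.Walk.cons_append, innerForall_append] at hcons
      obtain ⟨hc, hd, hcd⟩ := hcons
      refine ⟨q.dropUntil u hu, hq.dropUntil hu, hd, fun t ht hn => ?_⟩
      exact hcut _ SimpleGraph.Walk.not_nil_cons hc (by simpa using ht)
        (hcd SimpleGraph.Walk.not_nil_cons hn)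
    · exact ⟨.cons h q, hq.cons hu, hcons, fun t ht _ => by simpa using ht⟩

theorem separated_iff {X Y Z : Set W} (hXZ : Disjoint X Z) :
    Separated H X Y Z ↔ ∀ x ∈ X, ∀ y ∈ Y,
      ¬ Relation.ReflTransGen (fun s t => s ∉ Z ∧ t ∉ Z ∧ H.Adj s t) x y := by
  classical
  constructor
  · intro hsep x hx y hy h
    obtain ⟨p, hp⟩ : ∃ p : H.Walk x y, ∀ z ∈ p.support, z ∉ Z := by
      have hxZ := Set.disjoint_left.1 hXZ hx
      clear hsep hx hy
      induction h using Relation.ReflTransGen.head_induction_on with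
      | refl => exact ⟨.nil, by simpa using hxZ⟩
      | head h _ ih =>
        obtain ⟨p, hp⟩ := ih h.2.1
        exact ⟨.cons h.2.2 p, by simpa using ⟨hxZ, hp⟩⟩
    obtain ⟨z, hz, hzZ⟩ := hsep x hx y hy p.bypass p.bypass_isPath
    exact hp z (p.support_bypass_subset_support hz) hzZ
  · intro hsep x hx y hy p hpath
    by_contra! hp
    refine hsep x hx y hy ?_
    clear hsep hx hy hpath
    induction p with
    | nil => exact .refl
    | cons h p ih =>
      simp only [SimpleGraph.Walk.support_cons, List.mem_cons, forall_eq_or_imp] at hp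
      exact (ih hp.2).head ⟨hp.1, hp.2 _ p.start_mem_support, h⟩

end Walks

/-! ### Separation in terms of collider links -/

namespace MixedGraph

/-- A chain of collider links in `A` all of whose vertices avoid `Z`. -/
def LinkChain (G : MixedGraph V) (A Z : Set V) : V → V → Prop :=
  Relation.ReflTransGen fun s t => s ∉ Z ∧ t ∉ Z ∧ G.ColliderLinked A s t

/-- No chain of collider links in `an(X ∪ Y ∪ Z)` leads from `X` to `Y` and avoids `Z`.  This is
the common reformulation of m-separation and m*-separation. -/
def LinkSeparated (G : MixedGraph V) (X Y Z : Set V) : Prop :=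
  ∀ x ∈ X, ∀ y ∈ Y, ¬ G.LinkChain (G.an (X ∪ Y ∪ Z)) Z x y

/-- `v` is a collider between its neighbours `u` and `w`. -/
def Collider (G : MixedGraph V) (u v w : V) : Prop :=
  G.ArrowheadAt u v ∧ G.ArrowheadAt w v

/-- An m-connecting path given `Z` may pass from `u` through `v` to `w`. -/
def Unblocked (G : MixedGraph V) (Z : Set V) (u v w : V) : Prop :=
  (G.Collider u v w → v ∈ G.an Z) ∧ (¬ G.Collider u v w → v ∉ Z)

variable {G : MixedGraph V} {A X Y Z : Set V} {a b u v w x : V}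

theorem IsMVRChainGraph.not_arrowheadAt (hG : G.IsMVRChainGraph) (h : G.dir u v) :
    ¬ G.ArrowheadAt v u := fun h' =>
  hG u v h (.single h')

theorem dir_of_adj_of_not_arrowheadAt (h : G.skeleton.Adj u v) (h' : ¬ G.ArrowheadAt v u) :
    G.dir u v := by
  rcases h.2 with h | h | h
  · exact h
  · exact absurd (.inl h) h'
  · exact absurd (.inr h.symm) h'

theorem IsMVRChainGraph.skeleton_adj (hG : G.IsMVRChainGraph) (h : G.ArrowheadAt u v) :
    G.skeleton.Adj u v := by
  rcases h with h | h
  · exact ⟨fun e => hG u v h (e ▸ .refl), .inl h⟩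
  · exact ⟨h.ne, .inr (.inr h)⟩

theorem IsMVRChainGraph.induce (hG : G.IsMVRChainGraph) (A : Set V) :
    (G.induce A).IsMVRChainGraph := fun u v h h' =>
  hG u v h (Relation.ReflTransGen.lift (p := fun a b => G.dir a b ∨ G.bi.Adj a b) Subtype.val
    (fun _ _ h => h.imp_right SimpleGraph.induce_adj.1) v u h')

theorem mem_closedBlanket_of_arrowheadAt (hu : u ∈ A) (hv : v ∈ A) (h : G.ArrowheadAt u v) :
    u ∈ G.closedBlanket A v := by
  rcases h with h | h
  · exact ⟨v, mem_biDistrict_self, .inr h⟩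
  · exact ⟨u, .single ⟨hv, hu, h.symm⟩, .inl rfl⟩

theorem colliderLinked_of_adj (hu : u ∈ A) (hv : v ∈ A) (h : G.skeleton.Adj u v) :
    G.ColliderLinked A u v := by
  by_cases huv : G.ArrowheadAt u v
  · exact ⟨v, hv, mem_closedBlanket_of_arrowheadAt hu hv huv, mem_closedBlanket_self⟩
  · exact ⟨u, hu, mem_closedBlanket_self,
      mem_closedBlanket_of_arrowheadAt hv hu (.inl (dir_of_adj_of_not_arrowheadAt h.symm huv))⟩

/-! ### m*-separation -/

theorem exists_walk_of_mem_closedBlanket (hG : G.IsMVRChainGraph) {s v : A}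
    (h : (v : V) ∈ G.closedBlanket A s) : ∃ p : (G.induce A).skeleton.Walk s v,
      InnerForall (G.induce A).Collider p ∧ (¬ p.Nil → (G.induce A).ArrowheadAt p.snd s) := by
  obtain ⟨b, hb, hvb⟩ := h
  lift b to A using biDistrict_subset s.2 hb
  rw [mem_biDistrict_iff_reachable, SimpleGraph.reachable_iff_reflTransGen] at hb
  induction hb using Relation.ReflTransGen.head_induction_on with
  | refl =>
    rcases hvb with hvb | hvb
    · obtain rfl := Subtype.ext hvb
      exact ⟨.nil, innerForall_nil, fun hn => absurd SimpleGraph.Walk.nil_nil hn⟩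
    · have hvb : (G.induce A).ArrowheadAt v b := .inl hvb
      exact ⟨.cons ((hG.induce A).skeleton_adj hvb).symm .nil,
        innerForall_cons.2 ⟨innerForall_nil, fun hn => absurd SimpleGraph.Walk.nil_nil hn⟩,
        fun _ => by rwa [SimpleGraph.Walk.snd_cons]⟩
  | @head s c h _ ih =>
    obtain ⟨p, hp, hps⟩ := ih
    have hsc : (G.induce A).ArrowheadAt s c := .inr h
    exact ⟨.cons ((hG.induce A).skeleton_adj hsc) p,
      innerForall_cons.2 ⟨hp, fun hn => ⟨hsc, hps hn⟩⟩,
      fun _ => by rw [SimpleGraph.Walk.snd_cons]; exact .inr h.symm⟩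

theorem mem_closedBlanket_of_walk (hG : G.IsMVRChainGraph) {s v : A}
    (p : (G.induce A).skeleton.Walk s v) (hp : InnerForall (G.induce A).Collider p)
    (hs : ¬ p.Nil → (G.induce A).ArrowheadAt p.snd s) : (v : V) ∈ G.closedBlanket A s := by
  induction p with
  | nil => exact mem_closedBlanket_self
  | @cons s w v h p ih =>
    obtain ⟨hp, hc⟩ := innerForall_cons.1 hp
    have hws := hs SimpleGraph.Walk.not_nil_cons
    rw [SimpleGraph.Walk.snd_cons] at hws
    rcases hws with (hws : G.dir w s) | hws
    · have hnil : p.Nil := by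
        by_contra hn
        exact (hG.induce A).not_arrowheadAt hws (hc hn).1
      obtain rfl := hnil.eq
      exact ⟨s, mem_biDistrict_self, .inr hws⟩
    · have hsw : (w : V) ∈ G.biDistrict A s :=
        .single ⟨s.2, w.2, (SimpleGraph.induce_adj.1 hws).symm⟩
      rw [← closedBlanket_eq_of_mem hsw]
      exact ih hp fun hn => (hc hn).2

theorem augmented_induce_adj (hG : G.IsMVRChainGraph) {u v : A} :
    (G.induce A).augmented.Adj u v ↔ u ≠ v ∧ G.ColliderLinked A u v := by
  refine and_congr_right fun hne => ⟨?_, ?_⟩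
  · rintro ⟨p, -, hp : InnerForall (G.induce A).Collider p⟩
    cases p with
    | nil => exact absurd rfl hne
    | @cons _ w _ h p =>
      obtain ⟨hp, hc⟩ := innerForall_cons.1 hp
      by_cases huw : (G.induce A).ArrowheadAt u w
      · exact ⟨w, w.2, mem_closedBlanket_of_arrowheadAt u.2 w.2
          (huw.imp_right SimpleGraph.induce_adj.1),
          mem_closedBlanket_of_walk hG p hp fun hn => (hc hn).2⟩
      · have hnil : p.Nil := by
          by_contra hn
          exact huw (hc hn).1
        obtain rfl := hnil.eq
        have hwu : G.dir w u := dir_of_adj_of_not_arrowheadAt (G := G.induce A) h.symm huw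
        exact ⟨u, u.2, mem_closedBlanket_self, u, mem_biDistrict_self, .inr hwu⟩
  · rintro ⟨a, ha, ⟨b, hb, hub⟩, hv⟩
    lift b to A using biDistrict_subset ha hb
    rw [← closedBlanket_eq_of_mem hb] at hv
    obtain ⟨p, hp, hpb⟩ := exists_walk_of_mem_closedBlanket hG hv
    have key : ∃ q : (G.induce A).skeleton.Walk u v, InnerForall (G.induce A).Collider q := by
      rcases hub with hub | hub
      · obtain rfl := Subtype.ext hub
        exact ⟨p, hp⟩
      · have hub : (G.induce A).ArrowheadAt u b := .inl hub
        exact ⟨.cons ((hG.induce A).skeleton_adj hub) p,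
          innerForall_cons.2 ⟨hp, fun hn => ⟨hub, hpb hn⟩⟩⟩
    obtain ⟨q, hq⟩ := key
    obtain ⟨r, hr, hrc, -⟩ := hq.exists_isPath fun _ _ _ h h' => ⟨h.1, h'.2⟩
    exact ⟨r, hr, hrc⟩

theorem linkChain_coe_iff (hG : G.IsMVRChainGraph) (hA : G.AncestrallyClosed A) {x y : A} :
    G.LinkChain A Z x y ↔ Relation.ReflTransGen
      (fun s t => s ∉ Subtype.val ⁻¹' Z ∧ t ∉ Subtype.val ⁻¹' Z ∧ (G.induce A).augmented.Adj s t)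
      x y := by
  constructor
  · suffices key : ∀ {v : V} (_ : G.LinkChain A Z x v), ∃ hv : v ∈ A, Relation.ReflTransGen
        (fun s t => s ∉ Subtype.val ⁻¹' Z ∧ t ∉ Subtype.val ⁻¹' Z ∧
          (G.induce A).augmented.Adj s t) x ⟨v, hv⟩ from fun h => (key h).2
    intro v h
    induction h with
    | refl => exact ⟨x.2, .refl⟩
    | @tail s t _ h ih =>
      obtain ⟨hs, ih⟩ := ih
      obtain ⟨a, ha, -, hta⟩ := h.2.2
      refine ⟨closedBlanket_subset hA ha hta, ?_⟩
      by_cases hst : s = t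
      · subst hst
        exact ih
      · exact ih.tail ⟨h.1, h.2.1,
          (augmented_induce_adj hG).2 ⟨fun e => hst (congrArg Subtype.val e), h.2.2⟩⟩
  · exact Relation.ReflTransGen.lift Subtype.val
      (fun s t h => ⟨h.1, h.2.1, ((augmented_induce_adj hG).1 h.2.2).2⟩) x y

theorem mStarSeparated_iff_linkSeparated (hG : G.IsMVRChainGraph) (hXZ : Disjoint X Z) :
    G.MStarSeparated X Y Z ↔ G.LinkSeparated X Y Z := by
  have hsub : X ∪ Y ⊆ G.an (X ∪ Y ∪ Z) := Set.subset_union_left.trans subset_an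
  rw [MStarSeparated, separated_iff (hXZ.preimage _)]
  constructor
  · intro h x hx y hy hxy
    exact h ⟨x, hsub (.inl hx)⟩ hx ⟨y, hsub (.inr hy)⟩ hy
      ((linkChain_coe_iff hG ancestrallyClosed_an).1 hxy)
  · intro h x hx y hy hxy
    exact h x hx y hy ((linkChain_coe_iff hG ancestrallyClosed_an).2 hxy)

/-! ### m-separation -/

/-- Some walk from `v` to `Y` is m-connecting given `Z` at each of its inner vertices. -/
def OpenConnected (G : MixedGraph V) (Y Z : Set V) (v : V) : Prop :=
  ∃ y ∈ Y, ∃ p : G.skeleton.Walk v y, InnerForall (G.Unblocked Z) p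

/-- `OpenConnected` by a walk that stays m-connecting when an edge with an arrowhead at `v` is
prepended. -/
def HeadConnected (G : MixedGraph V) (Y Z : Set V) (v : V) : Prop :=
  ∃ y ∈ Y, ∃ p : G.skeleton.Walk v y, InnerForall (G.Unblocked Z) p ∧
    ∀ u, G.ArrowheadAt u v → ¬ p.Nil → G.Unblocked Z u v p.snd

-- The walk leaves `v` along directed edges until it reaches a collider or its end.
theorem mem_an_of_arrowheadAt {h : G.skeleton.Adj u v} {p : G.skeleton.Walk v b}
    (hp : InnerForall (G.Unblocked Z) (.cons h p)) (huv : G.ArrowheadAt u v) :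
    v ∈ G.an (insert b Z) := by
  induction p generalizing u with
  | nil => exact subset_an (Set.mem_insert _ _)
  | @cons v w b h' p ih =>
    obtain ⟨hp, hv⟩ := innerForall_cons.1 hp
    replace hv := hv SimpleGraph.Walk.not_nil_cons
    rw [SimpleGraph.Walk.snd_cons] at hv
    by_cases hwv : G.ArrowheadAt w v
    · exact an_mono (Set.subset_insert _ _) (hv.1 ⟨huv, hwv⟩)
    · have hvw := dir_of_adj_of_not_arrowheadAt h' hwv
      obtain ⟨c, hc, hwc⟩ := ih hp (.inl hvw)
      exact ⟨c, hc, hwc.head hvw⟩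

theorem Unblocked.of_closed_walk (hG : G.IsMVRChainGraph) (c : G.skeleton.Walk a a)
    (hn : ¬ c.Nil) (hc : InnerForall (G.Unblocked Z) c) (hu : G.Unblocked Z u a c.snd)
    (hw : G.Unblocked Z c.penultimate a w) : G.Unblocked Z u a w := by
  refine ⟨fun huw => ?_, fun huw => ?_⟩
  · by_cases hca : G.ArrowheadAt c.snd a
    · exact hu.1 ⟨huw.1, hca⟩
    · cases c with
      | nil => exact absurd SimpleGraph.Walk.nil_nil hn
      | @cons _ v _ h p =>
        rw [SimpleGraph.Walk.snd_cons] at hca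
        have hav := dir_of_adj_of_not_arrowheadAt h hca
        obtain ⟨z, rfl | hz, hvz⟩ := mem_an_of_arrowheadAt hc (.inl hav)
        · exact absurd (Relation.ReflTransGen.mono (fun _ _ => .inl) v z hvz) (hG z v hav)
        · exact ⟨z, hz, hvz.head hav⟩
  · by_cases hua : G.ArrowheadAt u a
    · exact hw.2 fun h => huw ⟨hua, h.2⟩
    · exact hu.2 fun h => hua h.1

theorem mSeparated_iff_not_openConnected (hG : G.IsMVRChainGraph) (hXZ : Disjoint X Z)
    (hYZ : Disjoint Y Z) : G.MSeparated X Y Z ↔ ∀ x ∈ X, ¬ G.OpenConnected Y Z x := by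
  constructor
  · rintro h x hx ⟨y, hy, p, hp⟩
    obtain ⟨q, hq, hqZ, -⟩ := hp.exists_isPath (Unblocked.of_closed_walk hG)
    exact h x hx y hy ⟨q, hq, Set.disjoint_left.1 hXZ hx, Set.disjoint_left.1 hYZ hy, hqZ⟩
  · rintro h x hx y hy ⟨p, -, -, -, hp⟩
    exact h x hx ⟨y, hy, p, hp⟩

theorem linkChain_of_walk (hG : G.IsMVRChainGraph) (hA : G.AncestrallyClosed A) (hZ : Z ⊆ A)
    {p : G.skeleton.Walk w b} (hp : InnerForall (G.Unblocked Z) p) (hw : w ∈ A) (hb : b ∈ A)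
    (hbZ : b ∉ Z) : (w ∉ Z → G.LinkChain A Z w b) ∧ (¬ p.Nil → G.ArrowheadAt p.snd w →
      ∃ m ∉ Z, m ∈ G.closedBlanket A w ∧ G.LinkChain A Z m b) := by
  induction p with
  | nil => exact ⟨fun _ => .refl, fun hn => absurd SimpleGraph.Walk.nil_nil hn⟩
  | @cons w v b h p ih =>
    have hv : v ∈ A := by
      by_cases hwv : G.ArrowheadAt w v
      · have hbZA : insert b Z ⊆ A := Set.insert_subset hb hZ
        exact hA ▸ an_mono hbZA (mem_an_of_arrowheadAt hp hwv)
      · exact ancestrallyClosed_iff.1 hA _ _ (dir_of_adj_of_not_arrowheadAt h.symm hwv) hw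
    obtain ⟨hp, hvp⟩ := innerForall_cons.1 hp
    obtain ⟨hchain, hblanket⟩ := ih hp hv hb hbZ
    have hcollider (hvZ : v ∈ Z) : ¬ p.Nil ∧ G.Collider w v p.snd := by
      have hn : ¬ p.Nil := fun hn => hbZ (hn.eq ▸ hvZ)
      exact ⟨hn, not_not.1 fun hc => (hvp hn).2 hc hvZ⟩
    refine ⟨fun hwZ => ?_, fun _ hvw => ?_⟩
    · by_cases hvZ : v ∈ Z
      · obtain ⟨hn, hwv, hsnd⟩ := hcollider hvZ
        obtain ⟨m, hmZ, hm, hmb⟩ := hblanket hn hsnd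
        exact hmb.head ⟨hwZ, hmZ, v, hv, mem_closedBlanket_of_arrowheadAt hw hv hwv, hm⟩
      · exact (hchain hvZ).head ⟨hwZ, hvZ, colliderLinked_of_adj hw hv h⟩
    · rw [SimpleGraph.Walk.snd_cons] at hvw
      by_cases hvZ : v ∈ Z
      · obtain ⟨hn, hwv, hsnd⟩ := hcollider hvZ
        have hbi : G.bi.Adj w v := hwv.resolve_left fun hdir => hG.not_arrowheadAt hdir hvw
        rw [← closedBlanket_eq_of_mem (.single ⟨hw, hv, hbi⟩)]
        exact hblanket hn hsnd
      · exact ⟨v, hvZ, mem_closedBlanket_of_arrowheadAt hv hw hvw, hchain hvZ⟩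

theorem OpenConnected.of_reflTransGen (hG : G.IsMVRChainGraph) (h : G.OpenConnected Y Z v)
    (hvx : Relation.ReflTransGen G.dir v x) (hv : v ∉ G.an Z) : G.OpenConnected Y Z x := by
  induction hvx with
  | refl => exact h
  | @tail s t hvs hst ih =>
    obtain ⟨y, hy, p, hp⟩ := ih
    refine ⟨y, hy, .cons (hG.skeleton_adj (.inl hst)).symm p, innerForall_cons.2 ⟨hp, fun _ => ?_⟩⟩
    exact ⟨fun hc => absurd hc.1 (hG.not_arrowheadAt hst), fun _ hs => hv ⟨s, hs, hvs⟩⟩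

theorem headConnected_of_mem (hv : v ∈ Y) : G.HeadConnected Y Z v :=
  ⟨v, hv, .nil, innerForall_nil, fun _ _ hn => absurd SimpleGraph.Walk.nil_nil hn⟩

theorem HeadConnected.of_dir (hG : G.IsMVRChainGraph) (h : G.HeadConnected Y Z v)
    (huv : G.dir u v) (hu : u ∉ Z) : G.HeadConnected Y Z u := by
  obtain ⟨y, hy, p, hp, hpv⟩ := h
  refine ⟨y, hy, .cons (hG.skeleton_adj (.inl huv)) p,
    innerForall_cons.2 ⟨hp, hpv u (.inl huv)⟩, fun t _ _ => ?_⟩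
  rw [SimpleGraph.Walk.snd_cons]
  exact ⟨fun hc => absurd hc.2 (hG.not_arrowheadAt huv), fun _ => hu⟩

theorem headConnected_of_mem_an (hG : G.IsMVRChainGraph) (hv : v ∈ G.an Y) (hvZ : v ∉ G.an Z) :
    G.HeadConnected Y Z v := by
  obtain ⟨y, hy, hvy⟩ := hv
  induction hvy using Relation.ReflTransGen.head_induction_on with
  | refl => exact headConnected_of_mem hy
  | head huv _ ih =>
    exact (ih fun ⟨z, hz, h⟩ => hvZ ⟨z, hz, h.head huv⟩).of_dir hG huv fun hu => hvZ (subset_an hu)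

theorem HeadConnected.of_arrowheadAt (hG : G.IsMVRChainGraph)
    (hno : ∀ x ∈ X, ¬ G.OpenConnected Y Z x) (h : G.HeadConnected Y Z v) (hvu : G.ArrowheadAt v u)
    (hv : ¬ G.ArrowheadAt u v → v ∉ Z) (hu : u ∈ G.an (X ∪ Y ∪ Z)) : G.HeadConnected Y Z u := by
  obtain ⟨y, hy, p, hp, hpv⟩ := h
  have hcons : InnerForall (G.Unblocked Z) (.cons (hG.skeleton_adj hvu).symm p) := by
    refine innerForall_cons.2 ⟨hp, fun hn => ?_⟩
    by_cases huv : G.ArrowheadAt u v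
    · exact hpv u huv hn
    · exact ⟨fun hc => absurd hc.1 huv, fun _ => hv huv⟩
  by_cases huZ : u ∈ G.an Z
  · refine ⟨y, hy, _, hcons, fun t htu _ => ?_⟩
    rw [SimpleGraph.Walk.snd_cons]
    exact ⟨fun _ => huZ, fun hc => absurd ⟨htu, hvu⟩ hc⟩
  · obtain ⟨z, (hz | hz) | hz, huz⟩ := hu
    · exact absurd (OpenConnected.of_reflTransGen hG ⟨y, hy, _, hcons⟩ huz huZ) (hno z hz)
    · exact headConnected_of_mem_an hG ⟨z, hz, huz⟩ huZ
    · exact absurd ⟨z, hz, huz⟩ huZ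

theorem HeadConnected.of_colliderLinked (hG : G.IsMVRChainGraph)
    (hno : ∀ x ∈ X, ¬ G.OpenConnected Y Z x) (h : G.HeadConnected Y Z v) (hv : v ∉ Z) (hu : u ∉ Z)
    (huv : G.ColliderLinked (G.an (X ∪ Y ∪ Z)) v u) : G.HeadConnected Y Z u := by
  obtain ⟨c, hc, ⟨s, hs, hvs⟩, ⟨t, ht, hut⟩⟩ := huv
  have hsA := biDistrict_subset hc hs
  have hs' : G.HeadConnected Y Z s := by
    rcases hvs with rfl | hvs
    · exact h
    · exact h.of_arrowheadAt hG hno (.inl hvs) (fun _ => hv) hsA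
  have ht' : G.HeadConnected Y Z t := by
    rw [← biDistrict_eq_of_mem hs] at ht
    clear hut
    induction ht with
    | refl => exact hs'
    | tail _ h ih =>
      exact ih.of_arrowheadAt hG hno (.inr h.2.2) (fun h' => absurd (.inr h.2.2.symm) h') h.2.1
  rcases hut with rfl | hut
  · exact ht'
  · exact ht'.of_dir hG hut hu

theorem mSeparated_iff_linkSeparated (hG : G.IsMVRChainGraph) (hXZ : Disjoint X Z)
    (hYZ : Disjoint Y Z) : G.MSeparated X Y Z ↔ G.LinkSeparated X Y Z := by
  rw [mSeparated_iff_not_openConnected hG hXZ hYZ]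
  constructor
  · intro hno x hx y hy hxy
    have hhead : G.HeadConnected Y Z x := by
      clear hx
      induction hxy using Relation.ReflTransGen.head_induction_on with
      | refl => exact headConnected_of_mem hy
      | head h _ ih => exact ih.of_colliderLinked hG hno h.2.1 h.1 h.2.2.symm
    obtain ⟨y, hy, p, hp, -⟩ := hhead
    exact hno x hx ⟨y, hy, p, hp⟩
  · rintro h x hx ⟨y, hy, p, hp⟩
    have hsub : X ∪ Y ∪ Z ⊆ G.an (X ∪ Y ∪ Z) := subset_an
    exact h x hx y hy ((linkChain_of_walk hG ancestrallyClosed_an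
      (Set.subset_union_right.trans hsub) hp (hsub (.inl (.inl hx))) (hsub (.inl (.inr hy)))
      (Set.disjoint_left.1 hYZ hy)).1 (Set.disjoint_left.1 hXZ hx))

end MixedGraph

/-! ### The global and the ordered local Markov property -/

section GlobalMarkov

variable {G : MixedGraph V} {I : IndependenceModel V} {lt : V → V → Prop} {A X Y Z : Set V} {x : V}

theorem PartitionMarkov.disjIndep_of_linkSeparated (hP : PartitionMarkov G I)
    (hI : IsSemiGraphoid I) (hXZ : Disjoint X Z) (hYZ : Disjoint Y Z)
    (h : G.LinkSeparated X Y Z) : DisjIndep I X Y Z := by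
  set A := G.an (X ∪ Y ∪ Z)
  let X' := {v ∈ A | v ∉ Z ∧ ∃ x ∈ X, G.LinkChain A Z x v}
  have hsub : X ∪ Y ∪ Z ⊆ A := subset_an
  have hX'Z : Disjoint X' Z := Set.disjoint_left.2 fun v hv => hv.2.1
  have hpart : IsUnlinkedPartition G A X' (A \ (X' ∪ Z)) Z := by
    refine ⟨?_, Set.disjoint_sdiff_right.mono_left Set.subset_union_left, hX'Z,
      Set.disjoint_sdiff_left.mono_right Set.subset_union_right, ?_⟩
    · rw [Set.union_right_comm, Set.union_sdiff_cancel]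
      exact Set.union_subset (Set.sep_subset _ _) (Set.subset_union_right.trans hsub)
    · rintro u ⟨-, huZ, x, hx, hxu⟩ v ⟨hvA, hv⟩ huv
      exact hv (.inl ⟨hvA, fun hvZ => hv (.inr hvZ), x, hx,
        hxu.tail ⟨huZ, fun hvZ => hv (.inr hvZ), huv⟩⟩)
  have hX : X ⊆ X' := fun v hv =>
    ⟨hsub (.inl (.inl hv)), Set.disjoint_left.1 hXZ hv, v, hv, .refl⟩
  have hY : Y ⊆ A \ (X' ∪ Z) := by
    refine fun v hv => ⟨hsub (.inl (.inr hv)), ?_⟩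
    rintro (⟨-, -, x, hx, hxv⟩ | hvZ)
    · exact h x hx v hv hxv
    · exact Set.disjoint_left.1 hYZ hv hvZ
  exact ((hP A ancestrallyClosed_an _ _ _ hpart).mono_left hI hX).mono_right hI hY

theorem PartitionMarkov.globalMarkov (hP : PartitionMarkov G I) (hI : IsSemiGraphoid I)
    (hG : G.IsMVRChainGraph) : GlobalMarkov G I := fun _ _ _ hX hY _ hXZ hYZ h =>
  (hP.disjIndep_of_linkSeparated hI hXZ hYZ
    ((mSeparated_iff_linkSeparated hG hXZ hYZ).1 h)).indep hX hY

theorem globalMarkov_iff_augmentedGlobalMarkov (hG : G.IsMVRChainGraph) :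
    GlobalMarkov G I ↔ AugmentedGlobalMarkov G I := by
  refine forall₃_congr fun X Y Z => forall₃_congr fun _ _ _ => forall₂_congr fun hXZ hYZ => ?_
  rw [mSeparated_iff_linkSeparated hG hXZ hYZ, mStarSeparated_iff_linkSeparated hG hXZ]

theorem MixedGraph.linkSeparated_closedBlanket (hA : G.AncestrallyClosed A) (hx : x ∈ A)
    (hchild : ∀ w ∈ A, ¬ G.dir x w) :
    G.LinkSeparated {x} (A \ G.closedBlanket A x) (G.closedBlanket A x \ {x}) := by
  have hunion : {x} ∪ (A \ G.closedBlanket A x) ∪ (G.closedBlanket A x \ {x}) = A := by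
    rw [Set.union_right_comm, Set.union_sdiff_cancel
      (Set.singleton_subset_iff.2 mem_closedBlanket_self), Set.union_sdiff_cancel
      (closedBlanket_subset hA hx)]
  simp only [LinkSeparated, Set.mem_singleton_iff, forall_eq]
  intro y hy hxy
  rw [hunion, hA] at hxy
  have hyx : y = x := by
    clear hy
    induction hxy with
    | refl => rfl
    | tail _ h ih =>
      subst ih
      by_contra hne
      exact h.2.1 ⟨h.2.2.mem_closedBlanket hchild, hne⟩
  exact hy.2 (hyx ▸ mem_closedBlanket_self)

theorem MixedGraph.IsConsistentVertexOrder.not_dir (hlt : G.IsConsistentVertexOrder lt)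
    (hG : G.IsMVRChainGraph) {w : V} (h : lt w x ∨ w = x) : ¬ G.dir x w := by
  intro hxw
  rcases h with h | rfl
  · exact hlt.consistent w x h ⟨w, rfl, .single hxw⟩
  · exact hG w w hxw .refl

theorem sdiff_mb_union_singleton (x : A) :
    A \ (G.mb A x ∪ {(x : V)}) = A \ G.closedBlanket A x := by
  rw [mb_eq, Set.sdiff_union_self,
    Set.union_eq_self_of_subset_right (Set.singleton_subset_iff.2 mem_closedBlanket_self)]

theorem GlobalMarkov.orderedLocalMarkov (h : GlobalMarkov G I) (hG : G.IsMVRChainGraph)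
    (hlt : G.IsConsistentVertexOrder lt) : OrderedLocalMarkov G lt I := by
  intro A x hA hAx hx hY
  have hZ : Disjoint (A \ G.closedBlanket A x) (G.closedBlanket A x \ {(x : V)}) :=
    Set.disjoint_sdiff_left.mono_right Set.sdiff_subset
  rw [sdiff_mb_union_singleton, mb_eq] at *
  refine h _ _ _ hx hY ?_ Set.disjoint_sdiff_right hZ ((mSeparated_iff_linkSeparated hG
    Set.disjoint_sdiff_right hZ).2 (linkSeparated_closedBlanket hA x.2 fun w hw =>
      hlt.not_dir hG (hAx hw)))
  exact Set.disjoint_singleton_left.2 fun hx => hx.2 mem_closedBlanket_self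

theorem OrderedLocalMarkov.partitionMarkov [Finite V] (h : OrderedLocalMarkov G lt I)
    (hI : IsSemiGraphoid I) (hG : G.IsMVRChainGraph) (hlt : G.IsConsistentVertexOrder lt) :
    PartitionMarkov G I := by
  have := hlt.isStrictTotalOrder
  refine partitionMarkov_of_local hI fun A hA hne => ?_
  obtain ⟨x, hx, hmax⟩ := (Finite.wellFounded_of_trans_of_irrefl (Function.swap lt)).has_min A hne
  have hAx : A ⊆ {v | lt v x ∨ v = x} := fun v hv => by
    rcases trichotomous_of lt v x with h | h | h
    · exact .inl h
    · exact .inr h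
    · exact absurd h (hmax v hv)
  refine ⟨x, hx, fun w hw => hlt.not_dir hG (hAx hw), ?_, Set.disjoint_sdiff_right,
    Set.disjoint_sdiff_left.mono_right Set.sdiff_subset, ?_⟩
  · exact Set.disjoint_singleton_left.2 fun hx => hx.2 mem_closedBlanket_self
  · have hlocal := h A ⟨x, hx⟩ hA hAx
    rwa [sdiff_mb_union_singleton, mb_eq] at hlocal

end GlobalMarkov

end MVR

theorem theorem2 {V : Type*} [Finite V] (G : MVR.MixedGraph V) (hG : G.IsMVRChainGraph)
    (compLt : G.ChainComponent → G.ChainComponent → Prop)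
    (hcomp : G.IsConsistentCompOrder compLt)
    (vertLt : V → V → Prop) (hvert : G.IsConsistentVertexOrder vertLt)
    (I : MVR.IndependenceModel V) (hI : MVR.IsSemiGraphoid I) :
    List.TFAE
      [MVR.GlobalMarkov G I,
       MVR.AugmentedGlobalMarkov G I,
       MVR.BlockRecursiveMarkov G I,
       MVR.MRMarkov G compLt I,
       MVR.OrderedLocalMarkov G vertLt I] := by
  tfae_have 1 ↔ 2 := MVR.globalMarkov_iff_augmentedGlobalMarkov hG
  tfae_have 1 → 5 := fun h => h.orderedLocalMarkov hG hvert
  tfae_have 5 → 3 := fun h => (h.partitionMarkov hI hG hvert).blockRecursive hI hG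
  tfae_have 3 → 4 := fun h => h.mrMarkov hI hG hcomp
  tfae_have 4 → 1 := fun h => (h.partitionMarkov hI hG hcomp).globalMarkov hI hG
  tfae_finish
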